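/- Call a real number $\alpha$ \emph{Liouville} if for every $n\in\mathbb{N}$ there are integers $p,q$ with $q>1$ and $\left|\alpha-\frac pq\right|\le q^{-n}$ (equality $\alpha=p/q$ is allowed, so every rational number is Liouville in this sense), and \emph{non-Liouville} otherwise. Theorem. Let $P\in\mathbb{R}[x]$ be a polynomial whose coefficient of $x$ is non-Liouville. For real $X$ let $$S(X)=\#\{x\in\mathbb{Z}:\ 1\le x\le X,\ \gcd(x,\lfloor P(x)\rfloor)=1\}.$$ Then, as $X\to\infty$, $$S(X)=\frac{X}{\zeta(2)}+O\left(\frac{X}{(\log\log X)^{1/3}}\right),$$ where the implied constant may depend on $P$, and hence $$\lim_{X\to\infty}\frac{S(X)}{X}=\frac1{\zeta(2)}=\frac{6}{\pi^2}.$$ -/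

import Mathlib

open Filter Topology Asymptotics

/-- `α` is Liouville if for every `n` there are integers `p`, `q` with `q > 1` and
`|α - p / q| ≤ q ^ (-n)`. Equality `α = p / q` is allowed, so every rational number is
Liouville in this sense (unlike Mathlib's `Liouville`, which implies irrationality). -/
def IsLiouvilleOrRational (α : ℝ) : Prop :=
  ∀ n : ℕ, ∃ p q : ℤ, 1 < q ∧ |α - (p : ℝ) / (q : ℝ)| ≤ 1 / (q : ℝ) ^ n

/-- `α` is non-Liouville: some power `q ^ (-n)` is a strict lower bound for the distance from `α`
to every fraction `p / q` with `q > 1`. -/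
def NonLiouville (α : ℝ) : Prop :=
  ¬ IsLiouvilleOrRational α

/-- The number of positive integers `x ≤ X` with `gcd (x, ⌊P x⌋) = 1`. The floor is an integer,
possibly negative or zero. -/
noncomputable def coprimeCount (P : Polynomial ℝ) (X : ℝ) : ℕ :=
  ((Finset.Icc 1 ⌊X⌋₊).filter fun x : ℕ => Int.gcd (x : ℤ) ⌊P.eval (x : ℝ)⌋ = 1).card

/-!
The Möbius function turns the count of `x ≤ N` with `gcd (x, ⌊P x⌋) = 1` into the counts `N_d` of
those `x ≤ N` for which `d` divides both `x` and `⌊P x⌋`. Writing `x = d * m`, the latter condition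
says that `{P (d * m) / d} < 1 / d`, and `P (d * m) / d` is a polynomial in `m` whose coefficient
of `m` is that of `P`, whatever `d` is. So it is enough to know that a polynomial sequence with a
non-Liouville linear coefficient is equidistributed modulo `1` with a power saving that does not
depend on the other coefficients (`NonLiouville.abs_card_fract_lt_sub_le`); this gives
`N_d = N / d ^ 2 + O ((N / d) ^ (1 - c))` uniformly in `d ≤ N`.

The equidistribution rests on an inverse theorem for exponential sums
(`exists_coeff_one_near_int_of_large_sum`): a polynomial phase of bounded degree has a sum of size
`M / R` only if its linear coefficient is within `R ^ C / M` of a rational with denominator at most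
`R ^ C`, up to the denominator. First, van der Corput differencing and a recurrence lemma show that
the leading coefficient is very close to a rational with small denominator
(`exists_near_int_of_large_sum_fwdDiff`). Summation by parts and a Fourier expansion modulo that
denominator then remove the leading term, at the cost of shifting the linear coefficient by a
rational with small denominator, and the degree drops by one. For a non-Liouville coefficient the
conclusion is impossible unless `R` exceeds a power of `M`. The passage from exponential sums to
counting uses the periodic Bernoulli function `B₂({x})`, whose Fourier series converges absolutely
and whose difference quotients approximate the sawtooth `{x} - 1/2` from both sides; the indicator
function of `{x} < δ` is `δ` plus a difference of two sawtooths.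

Finally, primes `p ≤ z` are removed by inclusion and exclusion, which yields the main term
`N / ζ(2)`; the primes between `z` and `N / T` remove few elements by the estimate for `N_p`; each
of the primes beyond `N / T` removes at most `T` elements, and there are `O (N / log N)` of them.
The choices `z ≈ log log N` and `T = (log N) ^ (1 / 2)` give the stated error term.
-/

/-! ### Phases and the van der Corput identity -/

/-- The additive character `x ↦ exp (2πix)` of `ℝ`, with values in `ℂ`. -/
noncomputable def phase (x : ℝ) : ℂ := Complex.exp ((2 * Real.pi * x : ℝ) * Complex.I)

lemma norm_phase (x : ℝ) : ‖phase x‖ = 1 := Complex.norm_exp_ofReal_mul_I _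

lemma phase_add (x y : ℝ) : phase (x + y) = phase x * phase y := by
  rw [phase, phase, phase, ← Complex.exp_add]; congr 1; push_cast; ring

lemma phase_int (n : ℤ) : phase n = 1 := by
  rw [phase, Complex.exp_eq_one_iff]; exact ⟨n, by push_cast; ring⟩

lemma conj_phase (x : ℝ) : (starRingEnd ℂ) (phase x) = phase (-x) := by
  rw [phase, phase, ← Complex.exp_conj, map_mul, Complex.conj_ofReal, Complex.conj_I]
  congr 1; push_cast; ring

lemma phase_nat_mul (n : ℕ) (x : ℝ) : phase (n * x) = phase x ^ n := by
  rw [phase, phase, ← Complex.exp_nat_mul]; congr 1; push_cast; ring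

lemma phase_sub_int (x : ℝ) (n : ℤ) : phase (x - n) = phase x := by
  have := phase_add (x - n) n
  rw [phase_int, mul_one, sub_add_cancel] at this
  exact this.symm

lemma phase_re (x : ℝ) : (phase x).re = Real.cos (2 * Real.pi * x) := by
  rw [phase, Complex.exp_ofReal_mul_I_re]

lemma norm_phase_sub_one (x : ℝ) : ‖phase x - 1‖ = 2 * |Real.sin (Real.pi * x)| := by
  have := Complex.norm_exp_I_mul_ofReal_sub_one (2 * Real.pi * x)
  rw [phase, mul_comm, this, Real.norm_eq_abs, abs_mul, abs_two]
  congr 3; ring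

/-- Jordan's inequality for the distance to the nearest integer. -/
lemma four_mul_abs_sub_round_le (x : ℝ) : 4 * |x - round x| ≤ ‖phase x - 1‖ := by
  rw [← phase_sub_int x (round x), norm_phase_sub_one]
  set y := x - round x
  have hy : |y| ≤ 1 / 2 := abs_sub_round x
  have h1 : |Real.sin (Real.pi * y)| = Real.sin (Real.pi * |y|) := by
    rcases abs_cases y with ⟨h, h0⟩ | ⟨h, h0⟩
    · rw [h, abs_of_nonneg]
      refine Real.sin_nonneg_of_nonneg_of_le_pi (by positivity) ?_
      nlinarith [Real.pi_pos]
    · rw [h, mul_neg, Real.sin_neg, abs_of_nonpos]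
      have : 0 ≤ Real.sin (Real.pi * (-y)) := by
        refine Real.sin_nonneg_of_nonneg_of_le_pi (by nlinarith [Real.pi_pos]) ?_
        nlinarith [Real.pi_pos]
      rw [mul_neg, Real.sin_neg] at this
      linarith
  rw [h1]
  have h2 := Real.mul_le_sin (x := Real.pi * |y|) (by positivity) (by nlinarith [Real.pi_pos])
  have h3 : 2 / Real.pi * (Real.pi * |y|) = 2 * |y| := by
    field_simp
  linarith

lemma norm_phase_sub_one_le (x : ℝ) : ‖phase x - 1‖ ≤ 7 * |x| := by
  rw [norm_phase_sub_one]
  have h1 : |Real.sin (Real.pi * x)| ≤ |Real.pi * x| := Real.abs_sin_le_abs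
  rw [abs_mul, abs_of_pos Real.pi_pos] at h1
  nlinarith [Real.pi_lt_d2, abs_nonneg x]

/-- The square of an exponential sum, with the off-diagonal terms grouped by the difference of
the two indices. -/
lemma norm_sum_range_sq (g : ℕ → ℂ) (N : ℕ) :
    ‖∑ m ∈ Finset.range N, g m‖ ^ 2 = ∑ m ∈ Finset.range N, ‖g m‖ ^ 2 +
      2 * (∑ h ∈ Finset.range N, ∑ m ∈ Finset.range (N - 1 - h),
        g (m + h + 1) * (starRingEnd ℂ) (g m)).re := by
  induction N with
  | zero => simp
  | succ N ih =>
    have key : ∑ h ∈ Finset.range (N + 1), ∑ m ∈ Finset.range (N + 1 - 1 - h),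
        g (m + h + 1) * (starRingEnd ℂ) (g m) =
        ∑ h ∈ Finset.range N, ∑ m ∈ Finset.range (N - 1 - h),
          g (m + h + 1) * (starRingEnd ℂ) (g m) +
        g N * (starRingEnd ℂ) (∑ m ∈ Finset.range N, g m) := by
      rw [Finset.sum_range_succ, ← Finset.sum_range_reflect g N, map_sum, Finset.mul_sum,
        ← Finset.sum_add_distrib]
      simp only [Nat.add_sub_cancel, Nat.sub_self, Finset.range_zero, Finset.sum_empty, add_zero]
      refine Finset.sum_congr rfl fun h hh => ?_
      have hh' := Finset.mem_range.1 hh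
      have e1 : N - h = (N - 1 - h) + 1 := by omega
      rw [e1, Finset.sum_range_succ]
      have e2 : N - 1 - h + h + 1 = N := by omega
      rw [e2]
    rw [Finset.sum_range_succ, Finset.sum_range_succ, key, Complex.add_re, mul_add, ← add_assoc,
      add_right_comm _ (‖g N‖ ^ 2), ← ih]
    rw [← Complex.normSq_eq_norm_sq, Complex.normSq_add, Complex.normSq_eq_norm_sq,
      Complex.normSq_eq_norm_sq, ← Complex.conj_re (g N * _), map_mul, Complex.conj_conj]
    ring_nf

lemma norm_sum_phase_range_le (f : ℕ → ℝ) (N : ℕ) :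
    ‖∑ m ∈ Finset.range N, phase (f m)‖ ≤ N := by
  refine (norm_sum_le _ _).trans ?_
  simp [norm_phase]

/-- The van der Corput inequality: the square of a sum of phases is bounded by the sums of their
differenced phases. -/
lemma norm_sum_phase_sq_le (f : ℕ → ℝ) (N : ℕ) :
    ‖∑ m ∈ Finset.range N, phase (f m)‖ ^ 2 ≤ N +
      2 * ∑ h ∈ Finset.range N,
        ‖∑ m ∈ Finset.range (N - 1 - h), phase (fwdDiff (h + 1) f m)‖ := by
  rw [norm_sum_range_sq]
  have h1 : ∑ m ∈ Finset.range N, ‖phase (f m)‖ ^ 2 = N := by simp [norm_phase]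
  rw [h1]
  gcongr
  refine (Complex.re_le_norm _).trans ((norm_sum_le _ _).trans (le_of_eq ?_))
  refine Finset.sum_congr rfl fun h _ => ?_
  congr 1
  refine Finset.sum_congr rfl fun m _ => ?_
  rw [conj_phase, ← phase_add, fwdDiff, ← sub_eq_add_neg, add_assoc]

/-! ### Recurrence of multiples near the integers -/

/-- If `h * β` is within `ε` of an integer for a proportion `1 / R` of all `h ≤ M`, then some
multiple `q * β` with `q ≤ 2 * R` is as close to an integer as `ε / M`, up to a power of `R`. -/
lemma exists_mul_near_int_of_many {β ε R : ℝ} {M : ℕ} {H : Finset ℕ} (hR : 2 ≤ R)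
    (hH : H ⊆ Finset.Icc 1 M) (hcard : (M : ℝ) ≤ R * H.card) (hM : 8 * R ≤ M)
    (hε : 32 * R ^ 2 * ε ≤ 1) (hε0 : 0 ≤ ε)
    (hnear : ∀ h ∈ H, ∃ p : ℤ, |h * β - p| ≤ ε) :
    ∃ q : ℕ, 1 ≤ q ∧ (q : ℝ) ≤ 2 * R ∧ ∃ p : ℤ, |q * β - p| ≤ 16 * R ^ 2 * ε / M := by
  have hM0 : (0 : ℝ) < M := by linarith
  have hcardM : (M : ℝ) / R ≤ H.card := by
    rw [div_le_iff₀ (by linarith)]; linarith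
  choose! n hn using hnear
  -- two elements of `H` at distance at most `2 * R`, by the pigeonhole principle
  obtain ⟨x, hx, y, hy, hxy, hxyR⟩ : ∃ x ∈ H, ∃ y ∈ H, x < y ∧ ((y - x : ℕ) : ℝ) ≤ 2 * R := by
    set L := ⌊2 * R⌋₊ with hL
    have hL1 : 2 * R - 1 < L := by have := Nat.lt_floor_add_one (2 * R); linarith
    have hL2 : (L : ℝ) ≤ 2 * R := Nat.floor_le (by linarith)
    have hLpos : 0 < L := by
      have : (0 : ℝ) < L := by linarith
      exact_mod_cast this
    have hmaps : ∀ h ∈ H, h / L ∈ Finset.range (M / L + 1) := by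
      intro h hh
      have := (Finset.mem_Icc.1 (hH hh)).2
      exact Finset.mem_range.2 (Nat.lt_succ_of_le (Nat.div_le_div_right this))
    have hlt : (Finset.range (M / L + 1)).card < H.card := by
      rw [Finset.card_range]
      have h1 : ((M / L : ℕ) : ℝ) ≤ M / L := Nat.cast_div_le
      have h2 : (M : ℝ) / L ≤ M / (3 / 2 * R) := by gcongr; linarith
      have h3 : (M : ℝ) / (3 / 2 * R) = 2 / 3 * (M / R) := by field_simp
      have h4 : 8 ≤ (M : ℝ) / R := by rw [le_div_iff₀ (by linarith)]; linarith
      have : ((M / L + 1 : ℕ) : ℝ) < H.card := by push_cast; linarith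
      exact_mod_cast this
    obtain ⟨x, hx, y, hy, hne, heq⟩ := Finset.exists_ne_map_eq_of_card_lt_of_maps_to hlt hmaps
    have aux : ∀ u v : ℕ, u / L = v / L → ((v - u : ℕ) : ℝ) ≤ 2 * R := by
      intro u v huv
      have h1 := Nat.div_add_mod u L
      have h2 := Nat.div_add_mod v L
      have h3 := Nat.mod_lt v hLpos
      rw [huv] at h1
      have : v - u ≤ L := by omega
      exact (Nat.cast_le.2 this).trans hL2
    rcases lt_or_gt_of_ne hne with h | h
    · exact ⟨x, hx, y, hy, h, aux x y heq⟩
    · exact ⟨y, hy, x, hx, h, aux y x heq.symm⟩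
  set q := y - x with hq
  set a : ℤ := n y - n x with ha
  set η : ℝ := q * β - a with hη
  have hq1 : 1 ≤ q := by omega
  have hq1' : (1 : ℝ) ≤ q := by exact_mod_cast hq1
  refine ⟨q, hq1, hxyR, a, ?_⟩
  change |η| ≤ _
  have hη2 : |η| ≤ 2 * ε := by
    have e : η = (y * β - n y) - (x * β - n x) := by
      rw [hη, hq, Nat.cast_sub hxy.le, ha]; push_cast; ring
    rw [e]
    refine (abs_sub _ _).trans ?_
    linarith [hn x hx, hn y hy]
  by_cases hη0 : η = 0
  · rw [hη0, abs_zero]; positivity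
  have hηpos : 0 < |η| := abs_pos.2 hη0
  set A : ℝ := 2 * q * ε with hA
  have hA0 : 0 ≤ A := by positivity
  have hηA : |η| ≤ A := by rw [hA]; nlinarith
  have hA4 : A ≤ 4 * R * ε := by rw [hA]; nlinarith
  have hA8 : A * (8 * R) ≤ 1 := by nlinarith
  -- the integer `q * n h - a * h` is close to `η * h`, so it takes few values, and each value
  -- few times
  set key : ℕ → ℤ := fun h => q * n h - a * h with hkey
  have key_near : ∀ h ∈ H, |(key h : ℝ) - η * h| ≤ q * ε := by
    intro h hh
    have e : (key h : ℝ) - η * h = -(q * (h * β - n h)) := by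
      rw [hkey, hη]; push_cast; ring
    rw [e, abs_neg, abs_mul, abs_of_nonneg (by positivity)]
    exact mul_le_mul_of_nonneg_left (hn h hh) (by positivity)
  have himage : ((H.image key).card : ℝ) ≤ |η| * M + 2 := by
    obtain ⟨u, huv⟩ : ∃ u : ℝ, ∀ h ∈ H, (key h : ℝ) ∈ Set.Icc u (u + (|η| * M + A)) := by
      rcases abs_cases η with ⟨e, h0⟩ | ⟨e, h0⟩
      · refine ⟨-(q * ε), fun h hh => ?_⟩
        have h1 := abs_le.1 (key_near h hh)
        have h2 : (h : ℝ) ≤ M := by exact_mod_cast (Finset.mem_Icc.1 (hH hh)).2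
        have h3 : (0 : ℝ) ≤ h := Nat.cast_nonneg _
        rw [e]
        constructor <;> nlinarith [h1.1, h1.2]
      · refine ⟨η * M - q * ε, fun h hh => ?_⟩
        have h1 := abs_le.1 (key_near h hh)
        have h2 : (h : ℝ) ≤ M := by exact_mod_cast (Finset.mem_Icc.1 (hH hh)).2
        have h3 : (0 : ℝ) ≤ h := Nat.cast_nonneg _
        rw [e]
        constructor <;> nlinarith [h1.1, h1.2]
    have hsub : H.image key ⊆ Finset.Icc ⌈u⌉ ⌊u + (|η| * M + A)⌋ := by
      intro k hk
      obtain ⟨h, hh, rfl⟩ := Finset.mem_image.1 hk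
      exact Finset.mem_Icc.2 ⟨Int.ceil_le.2 (huv h hh).1, Int.le_floor.2 (huv h hh).2⟩
    have h1 : ((H.image key).card : ℝ) ≤ ((Finset.Icc ⌈u⌉ ⌊u + (|η| * M + A)⌋).card : ℝ) :=
      by exact_mod_cast Finset.card_le_card hsub
    refine h1.trans ?_
    rw [Int.card_Icc]
    have h2 : (((⌊u + (|η| * M + A)⌋ + 1 - ⌈u⌉).toNat : ℤ) : ℝ) ≤
        max (⌊u + (|η| * M + A)⌋ + 1 - ⌈u⌉ : ℤ) (0 : ℤ) := by
      rw [Int.toNat_eq_max]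
    have h3 : (((⌊u + (|η| * M + A)⌋ + 1 - ⌈u⌉).toNat : ℤ) : ℝ) =
      ((⌊u + (|η| * M + A)⌋ + 1 - ⌈u⌉).toNat : ℝ) := by push_cast; rfl
    rw [← h3]
    refine h2.trans ?_
    have h4 := Int.floor_le (u + (|η| * M + A))
    have h5 := Int.le_ceil u
    have h6 : A ≤ 1 := by nlinarith
    push_cast
    refine max_le (by linarith) (by positivity)
  have hfiber : ∀ k ∈ H.image key, (H.filter fun h => key h = k).card ≤ ⌊A / |η|⌋₊ + 1 := by
    intro k hk
    set F := H.filter fun h => key h = k with hF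
    obtain ⟨h0, hh0, hk0⟩ := Finset.mem_image.1 hk
    have hne : F.Nonempty := ⟨h0, Finset.mem_filter.2 ⟨hh0, hk0⟩⟩
    set m := F.min' hne
    have hm : m ∈ F := F.min'_mem hne
    have hsub : F ⊆ Finset.Icc m (m + ⌊A / |η|⌋₊) := by
      intro h hh
      have hmh : m ≤ h := F.min'_le _ hh
      refine Finset.mem_Icc.2 ⟨hmh, ?_⟩
      have h1 := key_near h (Finset.mem_filter.1 hh).1
      have h2 := key_near m (Finset.mem_filter.1 hm).1
      rw [(Finset.mem_filter.1 hh).2] at h1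
      rw [(Finset.mem_filter.1 hm).2] at h2
      have h3 : |η| * (h - m : ℝ) ≤ A := by
        have e : |η| * (h - m : ℝ) = |((k : ℝ) - η * m) - (k - η * h)| := by
          rw [show ((k : ℝ) - η * m) - (k - η * h) = η * (h - m) by ring, abs_mul,
            abs_of_nonneg (a := (h - m : ℝ)) (sub_nonneg.2 (by exact_mod_cast hmh))]
        rw [e, hA]
        exact (abs_sub _ _).trans (by linarith)
      have h4 : h - m ≤ ⌊A / |η|⌋₊ := by
        refine Nat.le_floor ?_
        rw [Nat.cast_sub hmh, le_div_iff₀ hηpos]; linarith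
      omega
    refine (Finset.card_le_card hsub).trans ?_
    rw [Nat.card_Icc]; omega
  have hcount := Finset.card_le_mul_card_image (f := key) H _ hfiber
  have hcount' : (H.card : ℝ) ≤ (A / |η| + 1) * (|η| * M + 2) := by
    have h1 : (H.card : ℝ) ≤ ((⌊A / |η|⌋₊ + 1 : ℕ) : ℝ) * ((H.image key).card : ℝ) := by
      exact_mod_cast hcount
    refine h1.trans ?_
    push_cast
    gcongr
    exact Nat.floor_le (by positivity)
  have e : (A / |η| + 1) * (|η| * M + 2) = A * M + |η| * M + 2 * (A / |η|) + 2 := by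
    field_simp; ring
  rw [e] at hcount'
  set D := (M : ℝ) / R with hD
  have hMD : (M : ℝ) = D * R := by rw [hD]; field_simp
  have hD8 : 8 ≤ D := by rw [hD, le_div_iff₀ (by linarith)]; linarith
  have h1 : A * M ≤ D / 8 := by rw [hMD]; nlinarith
  have h2 : |η| * M ≤ D / 8 := (mul_le_mul_of_nonneg_right hηA hM0.le).trans h1
  have h3 : D / 4 ≤ A / |η| := by linarith
  rw [le_div_iff₀ hM0]
  rw [le_div_iff₀ hηpos] at h3
  have h4 : |η| * D ≤ 16 * R * ε := by linarith
  calc |η| * M = |η| * D * R := by rw [hMD]; ring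
    _ ≤ 16 * R * ε * R := by gcongr
    _ = _ := by ring

/-! ### The leading coefficient of a polynomial phase with a large sum -/

lemma eq_add_mul_of_fwdDiff_one_eq_const {g : ℕ → ℝ} {β : ℝ} (hg : fwdDiff 1 g = fun _ => β)
    (n : ℕ) : g n = g 0 + n * β := by
  induction n with
  | zero => simp
  | succ n ih =>
    have := congrFun hg n
    rw [fwdDiff] at this
    push_cast
    linarith

lemma fwdDiff_iter_fwdDiff_of_eq_const {f : ℕ → ℝ} {β : ℝ} {k : ℕ}
    (hf : (fwdDiff 1)^[k + 1] f = fun _ => β) (h : ℕ) :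
    (fwdDiff 1)^[k] (fwdDiff h f) = fun _ => h * β := by
  have hcomm : Function.Commute (fwdDiff 1 : (ℕ → ℝ) → ℕ → ℝ) (fwdDiff h) := by
    intro g
    funext n
    simp only [fwdDiff]
    rw [add_right_comm]
    ring
  rw [hcomm.iterate_left k f]
  rw [Function.iterate_succ_apply'] at hf
  funext n
  rw [fwdDiff, eq_add_mul_of_fwdDiff_one_eq_const hf n,
    eq_add_mul_of_fwdDiff_one_eq_const hf (n + h)]
  push_cast
  ring

lemma norm_sum_phase_linear_mul_le {f : ℕ → ℝ} {β : ℝ} (hf : fwdDiff 1 f = fun _ => β) (N : ℕ) :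
    ‖∑ m ∈ Finset.range N, phase (f m)‖ * ‖phase β - 1‖ ≤ 2 := by
  have h1 : ∀ m ∈ Finset.range N, phase (f m) = phase (f 0) * phase β ^ m := by
    intro m _
    rw [eq_add_mul_of_fwdDiff_one_eq_const hf m, phase_add, phase_nat_mul]
  rw [Finset.sum_congr rfl h1, ← Finset.mul_sum, norm_mul, norm_phase, one_mul, ← norm_mul,
    geom_sum_mul]
  refine (norm_sub_le _ _).trans ?_
  rw [norm_pow, norm_phase]
  norm_num

/-- A sum of `N ≤ M` terms `phase (f m)`, with `f` of constant `(k + 1)`-st difference `β`, can be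
at least `M / R` only if a multiple of `β` by some `q ≤ R ^ C` is within `R ^ C / M ^ (k + 1)` of
an integer. -/
theorem exists_near_int_of_large_sum_fwdDiff (k : ℕ) : ∃ C : ℕ, ∀ (R : ℝ) (M N : ℕ) (f : ℕ → ℝ)
    (β : ℝ), 2 ≤ R → 1 ≤ M → N ≤ M → (fwdDiff 1)^[k + 1] f = (fun _ => β) →
    (M : ℝ) ≤ R * ‖∑ m ∈ Finset.range N, phase (f m)‖ →
    ∃ q : ℕ, 1 ≤ q ∧ (q : ℝ) ≤ R ^ C ∧ ∃ p : ℤ, |q * β - p| ≤ R ^ C / (M : ℝ) ^ (k + 1) := by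
  induction k with
  | zero =>
    refine ⟨1, fun R M N f β hR hM hN hf hlarge => ⟨1, le_rfl, by norm_num; linarith,
      round β, ?_⟩⟩
    have hM' : (0 : ℝ) < M := by exact_mod_cast hM
    have h1 := norm_sum_phase_linear_mul_le (f := f) (by simpa using hf) N
    have h2 := four_mul_abs_sub_round_le β
    set S := ‖∑ m ∈ Finset.range N, phase (f m)‖
    have h3 : 0 ≤ |β - round β| := abs_nonneg _
    simp only [Nat.cast_one, one_mul, zero_add, pow_one]
    rw [le_div_iff₀ hM']
    have hS : 0 ≤ S := norm_nonneg _
    have h4 : S * |β - round β| ≤ 1 := by nlinarith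
    calc |β - round β| * M ≤ |β - round β| * (R * S) := by gcongr
      _ = R * (S * |β - round β|) := by ring
      _ ≤ R * 1 := by gcongr
      _ = R := mul_one R
  | succ k ih =>
    obtain ⟨C, hC⟩ := ih
    refine ⟨(15 + 15 * C) * (k + 2), fun R M N f β hR hM hN hf hlarge => ?_⟩
    have hM1 : (1 : ℝ) ≤ M := by exact_mod_cast hM
    have hM' : (0 : ℝ) < M := by linarith
    have hR1 : 1 ≤ R := by linarith
    have hexp : ∀ {i : ℕ}, i ≤ (15 + 15 * C) * (k + 2) → R ^ i ≤ R ^ ((15 + 15 * C) * (k + 2)) :=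
      fun hi => pow_le_pow_right₀ hR1 hi
    have h8 : 8 * R ^ 2 ≤ R ^ 5 := by
      have : (2 : ℝ) ^ 3 ≤ R ^ 3 := by gcongr
      nlinarith [sq_nonneg R]
    set Q : ℝ := (8 * R ^ 2) ^ C with hQ
    set R₁ : ℝ := 8 * R ^ 2 * Q with hR₁
    have hQ1 : 1 ≤ Q := one_le_pow₀ (by nlinarith)
    have hQR : Q ≤ R ^ (5 * C) := by
      rw [hQ, pow_mul]; gcongr
    have hR₁R : R₁ ≤ R ^ (5 + 5 * C) := by
      rw [hR₁, pow_add]; gcongr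
    have hR₁8 : 8 * R ^ 2 ≤ R₁ := by rw [hR₁]; nlinarith [sq_nonneg R]
    have hR₁2 : 2 ≤ R₁ := by nlinarith
    have hbig : 32 * R₁ ^ 2 * Q ≤ R ^ (15 + 15 * C) := by
      have h2 : (2 : ℝ) ^ 5 ≤ R ^ 5 := by gcongr
      calc 32 * R₁ ^ 2 * Q ≤ R ^ 5 * (R ^ (5 + 5 * C)) ^ 2 * R ^ (5 * C) := by
            gcongr; linarith
        _ = R ^ (15 + 15 * C) := by ring
    rcases lt_or_ge (M : ℝ) (32 * R₁ ^ 2 * Q) with hsmall | hMbig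
    · -- for small `M` the asserted approximation is weaker than the trivial one
      refine ⟨1, le_rfl, ?_, round β, ?_⟩
      · rw [Nat.cast_one]; exact one_le_pow₀ hR1
      · rw [Nat.cast_one, one_mul, le_div_iff₀ (by positivity)]
        have h1 := abs_sub_round β
        have h2 : (M : ℝ) ^ (k + 1 + 1) ≤ R ^ ((15 + 15 * C) * (k + 2)) := by
          rw [pow_mul]
          gcongr
          linarith
        calc |β - round β| * (M : ℝ) ^ (k + 1 + 1) ≤ 1 * (M : ℝ) ^ (k + 1 + 1) := by
              gcongr; linarith
          _ ≤ _ := by rw [one_mul]; exact h2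
    -- many differences have a large sum
    set T : ℕ → ℝ := fun h => ‖∑ m ∈ Finset.range (N - 1 - h), phase (fwdDiff (h + 1) f m)‖ with hT
    set H := (Finset.range N).filter fun h => (M : ℝ) ≤ 8 * R ^ 2 * T h with hH
    have hTM : ∀ h, T h ≤ M := fun h => (norm_sum_phase_range_le _ _).trans
      (by exact_mod_cast (by omega : N - 1 - h ≤ M))
    have hHcard : (M : ℝ) ≤ 4 * R ^ 2 * H.card := by
      have h1 := norm_sum_phase_sq_le f N
      have h2 : ∑ h ∈ Finset.range N, T h ≤ M * H.card + M * (M / (8 * R ^ 2)) := by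
        rw [← Finset.sum_filter_add_sum_filter_not _ (fun h => (M : ℝ) ≤ 8 * R ^ 2 * T h)]
        refine add_le_add ?_ ?_
        · refine (Finset.sum_le_card_nsmul _ _ (M : ℝ) fun h _ => hTM h).trans ?_
          rw [nsmul_eq_mul, mul_comm]
        · refine (Finset.sum_le_card_nsmul _ _ ((M : ℝ) / (8 * R ^ 2)) fun h hh => ?_).trans ?_
          · have := (Finset.mem_filter.1 hh).2
            rw [le_div_iff₀ (by positivity)]
            linarith
          · rw [nsmul_eq_mul]
            gcongr
            refine (Finset.card_filter_le _ _).trans ?_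
            rw [Finset.card_range]; exact hN
      set S := ‖∑ m ∈ Finset.range N, phase (f m)‖
      have h3 : (M / R : ℝ) ^ 2 ≤ S ^ 2 := by
        gcongr
        rw [div_le_iff₀ (by linarith)]; linarith
      have hN' : (N : ℝ) ≤ M := by exact_mod_cast hN
      have h4 : (M / R : ℝ) ^ 2 ≤ M + 2 * (M * H.card + M * (M / (8 * R ^ 2))) := by
        linarith
      have h5 : 8 * R ^ 2 ≤ M := by nlinarith
      have h6 : (M : ℝ) * M ≤ M * (R ^ 2 + 2 * R ^ 2 * H.card + M / 4) := by
        have e : (M : ℝ) * M = (M / R : ℝ) ^ 2 * R ^ 2 := by field_simp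
        rw [e]
        refine (mul_le_mul_of_nonneg_right h4 (by positivity)).trans (le_of_eq ?_)
        field_simp
        ring
      have h7 := le_of_mul_le_mul_left h6 hM'
      linarith
    -- the multipliers furnished by the induction hypothesis are constant on a large subset
    have hIH : ∀ h ∈ H, ∃ q : ℕ, 1 ≤ q ∧ (q : ℝ) ≤ Q ∧
        ∃ p : ℤ, |q * ((h + 1 : ℕ) * β) - p| ≤ Q / (M : ℝ) ^ (k + 1) := by
      intro h hh
      exact hC (8 * R ^ 2) M (N - 1 - h) (fwdDiff (h + 1) f) ((h + 1 : ℕ) * β) (by nlinarith) hM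
        (by omega) (fwdDiff_iter_fwdDiff_of_eq_const hf (h + 1)) (Finset.mem_filter.1 hh).2
    choose! q hq1 hqQ p hp using hIH
    have hmaps : ∀ h ∈ H, q h ∈ Finset.Icc 1 ⌊Q⌋₊ := fun h hh =>
      Finset.mem_Icc.2 ⟨hq1 h hh, Nat.le_floor (hqQ h hh)⟩
    have hQfl : 1 ≤ ⌊Q⌋₊ := Nat.le_floor (by exact_mod_cast hQ1)
    obtain ⟨q₀, hq₀, hfib⟩ := Finset.exists_le_card_fiber_of_nsmul_le_card_of_maps_to
      (b := (H.card : ℝ) / ⌊Q⌋₊) hmaps ⟨1, Finset.mem_Icc.2 ⟨le_rfl, hQfl⟩⟩ (by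
        rw [Nat.card_Icc, nsmul_eq_mul, Nat.add_sub_cancel]
        refine le_of_eq (mul_div_cancel₀ _ ?_)
        exact_mod_cast (by omega : ⌊Q⌋₊ ≠ 0))
    set H₀ := H.filter fun h => q h = q₀ with hH₀
    have hq₀' := Finset.mem_Icc.1 hq₀
    have hq₀Q : (q₀ : ℝ) ≤ Q := (Nat.cast_le.2 hq₀'.2).trans (Nat.floor_le (by linarith))
    have hH₀card : (H.card : ℝ) ≤ Q * H₀.card := by
      have hfl : (0 : ℝ) < ⌊Q⌋₊ := by exact_mod_cast hQfl
      rw [div_le_iff₀ hfl, mul_comm] at hfib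
      refine hfib.trans ?_
      gcongr
      exact Nat.floor_le (by linarith)
    have hinj : (H₀.image (· + 1)).card = H₀.card :=
      Finset.card_image_of_injective _ (add_left_injective 1)
    obtain ⟨r, hr1, hrR, p', hp'⟩ := exists_mul_near_int_of_many (β := q₀ * β)
      (ε := Q / (M : ℝ) ^ (k + 1)) (R := R₁) (M := M) (H := H₀.image (· + 1)) hR₁2
      (by
        intro h hh
        obtain ⟨h', hh', rfl⟩ := Finset.mem_image.1 hh
        have := Finset.mem_range.1 (Finset.mem_filter.1 (Finset.mem_filter.1 hh').1).1
        exact Finset.mem_Icc.2 ⟨by omega, by omega⟩)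
      (by
        rw [hinj]
        refine hHcard.trans ?_
        calc 4 * R ^ 2 * H.card ≤ 4 * R ^ 2 * (Q * H₀.card) := by gcongr
          _ ≤ 8 * R ^ 2 * (Q * H₀.card) := by gcongr; norm_num
          _ = R₁ * H₀.card := by rw [hR₁]; ring)
      (by nlinarith)
      (by
        rw [← mul_div_assoc, div_le_one (by positivity)]
        exact hMbig.trans (le_self_pow₀ hM1 (by omega)))
      (by positivity)
      (by
        intro h hh
        obtain ⟨h', hh', rfl⟩ := Finset.mem_image.1 hh
        have h1 := Finset.mem_filter.1 hh'
        refine ⟨p h', ?_⟩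
        have h2 := hp h' h1.1
        rw [h1.2] at h2
        rwa [mul_left_comm] at h2)
    refine ⟨r * q₀, Nat.mul_pos hr1 hq₀'.1, ?_, p', ?_⟩
    · push_cast
      calc (r : ℝ) * q₀ ≤ (2 * R₁) * Q := by gcongr
        _ ≤ (R * R ^ (5 + 5 * C)) * R ^ (5 * C) := by gcongr
        _ = R ^ (6 + 10 * C) := by ring
        _ ≤ _ := hexp (by nlinarith [Nat.zero_le (C * k)])
    · push_cast
      rw [mul_assoc]
      refine hp'.trans ?_
      rw [← mul_div_assoc, div_div, ← pow_succ]
      gcongr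
      calc 16 * R₁ ^ 2 * Q ≤ 32 * R₁ ^ 2 * Q := by gcongr; norm_num
        _ ≤ R ^ (15 + 15 * C) := hbig
        _ ≤ _ := hexp (by nlinarith [Nat.zero_le (C * k)])

/-! ### The linear coefficient of a polynomial phase with a large sum -/

lemma fwdDiff_iter_natCast (F : ℝ → ℝ) (a n : ℕ) :
    (fwdDiff 1)^[n] (fun m : ℕ => F ((a + m : ℕ) : ℝ)) =
      fun m : ℕ => (fwdDiff (1 : ℝ))^[n] F ((a + m : ℕ) : ℝ) := by
  induction n with
  | zero => rfl
  | succ n ih =>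
    rw [Function.iterate_succ_apply', ih, Function.iterate_succ_apply']
    funext m
    simp only [fwdDiff]
    push_cast
    rw [add_assoc]

lemma fwdDiff_iter_eval_of_natDegree_le {P : Polynomial ℝ} {n : ℕ} (hP : P.natDegree ≤ n) :
    (fwdDiff (1 : ℝ))^[n] P.eval = fun _ => (n.factorial : ℝ) * P.coeff n := by
  rcases hP.lt_or_eq with h | rfl
  · rw [Polynomial.fwdDiff_iter_eq_zero_of_degree_lt h, Polynomial.coeff_eq_zero_of_natDegree_lt h]
    funext x
    simp
  · rw [Polynomial.fwdDiff_iter_degree_eq_factorial]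
    funext x
    simp [mul_comm]

lemma sum_Ico_mul_eq_by_parts (u v : ℕ → ℂ) {a b : ℕ} (hab : a ≤ b) :
    ∑ m ∈ Finset.Ico a b, u m * v m = (∑ m ∈ Finset.Ico a b, u m) * v b -
      ∑ j ∈ Finset.Ico a b, (∑ m ∈ Finset.Ico a (j + 1), u m) * (v (j + 1) - v j) := by
  induction b, hab using Nat.le_induction with
  | base => simp
  | succ b hab ih =>
    rw [Finset.sum_Ico_succ_top hab, ih, Finset.sum_Ico_succ_top hab (fun j => _ * _),
      Finset.sum_Ico_succ_top hab u]
    ring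

/-- Summation by parts: a factor of small total variation can be removed from a sum, at the
expense of shortening the interval of summation. -/
lemma exists_norm_sum_mul_le (u v : ℕ → ℂ) {a b : ℕ} (hab : a ≤ b) {V : ℝ}
    (hv : ‖v b‖ ≤ 1) (hV : ∑ j ∈ Finset.Ico a b, ‖v (j + 1) - v j‖ ≤ V) :
    ∃ c ≤ b, ‖∑ m ∈ Finset.Ico a b, u m * v m‖ ≤ (1 + V) * ‖∑ m ∈ Finset.Ico a c, u m‖ := by
  obtain ⟨c, hc, hmax⟩ := (Finset.Icc a b).exists_max_image
    (fun c => ‖∑ m ∈ Finset.Ico a c, u m‖) ⟨b, Finset.mem_Icc.2 ⟨hab, le_rfl⟩⟩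
  refine ⟨c, (Finset.mem_Icc.1 hc).2, ?_⟩
  set B := ‖∑ m ∈ Finset.Ico a c, u m‖
  rw [sum_Ico_mul_eq_by_parts u v hab, add_mul, one_mul]
  refine (norm_sub_le _ _).trans (add_le_add ?_ ?_)
  · rw [norm_mul]
    refine (mul_le_of_le_one_right (norm_nonneg _) hv).trans ?_
    exact hmax b (Finset.mem_Icc.2 ⟨hab, le_rfl⟩)
  · refine (norm_sum_le _ _).trans ?_
    calc ∑ j ∈ Finset.Ico a b, ‖(∑ m ∈ Finset.Ico a (j + 1), u m) * (v (j + 1) - v j)‖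
        ≤ ∑ j ∈ Finset.Ico a b, B * ‖v (j + 1) - v j‖ := by
          refine Finset.sum_le_sum fun j hj => ?_
          rw [norm_mul]
          gcongr
          have := Finset.mem_Ico.1 hj
          exact hmax (j + 1) (Finset.mem_Icc.2 ⟨by omega, by omega⟩)
      _ = B * ∑ j ∈ Finset.Ico a b, ‖v (j + 1) - v j‖ := by rw [Finset.mul_sum]
      _ ≤ B * V := by gcongr
      _ = V * B := mul_comm _ _

lemma sum_norm_phase_mul_pow_sub_le (θ : ℝ) (n a b : ℕ) :
    ∑ j ∈ Finset.Ico a b, ‖phase (θ * ((j + 1 : ℕ) : ℝ) ^ n) - phase (θ * (j : ℝ) ^ n)‖ ≤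
      7 * |θ| * (b : ℝ) ^ n := by
  have h1 : ∀ j ∈ Finset.Ico a b,
      ‖phase (θ * ((j + 1 : ℕ) : ℝ) ^ n) - phase (θ * (j : ℝ) ^ n)‖ ≤
        7 * |θ| * (((j + 1 : ℕ) : ℝ) ^ n - (j : ℝ) ^ n) := by
    intro j _
    have e : θ * ((j + 1 : ℕ) : ℝ) ^ n =
        θ * (j : ℝ) ^ n + θ * (((j + 1 : ℕ) : ℝ) ^ n - (j : ℝ) ^ n) := by ring
    rw [e, phase_add, ← mul_sub_one, norm_mul, norm_phase, one_mul]
    refine (norm_phase_sub_one_le _).trans (le_of_eq ?_)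
    have : (j : ℝ) ^ n ≤ ((j + 1 : ℕ) : ℝ) ^ n := by gcongr; omega
    rw [abs_mul, abs_of_nonneg (sub_nonneg.2 this), mul_assoc]
  refine (Finset.sum_le_sum h1).trans ?_
  rw [← Finset.mul_sum]
  gcongr
  rcases le_total a b with hab | hab
  · rw [Finset.sum_Ico_sub (fun j : ℕ => (j : ℝ) ^ n) hab]
    simp
  · rw [Finset.Ico_eq_empty_of_le hab, Finset.sum_empty]
    positivity

lemma sum_range_phase_div {q : ℕ} (hq : 1 ≤ q) (n : ℤ) :
    ∑ t ∈ Finset.range q, phase (t * ((n : ℝ) / q)) = if (q : ℤ) ∣ n then (q : ℂ) else 0 := by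
  have hq0 : (q : ℝ) ≠ 0 := by exact_mod_cast (by omega : q ≠ 0)
  simp only [phase_nat_mul]
  split_ifs with h
  · obtain ⟨k, rfl⟩ := h
    have e : (((q : ℤ) * k : ℤ) : ℝ) / q = (k : ℤ) := by push_cast; field_simp
    rw [e]
    simp [phase_int]
  · have hne : phase ((n : ℝ) / q) ≠ 1 := by
      intro h1
      rw [phase, Complex.exp_eq_one_iff] at h1
      obtain ⟨k, hk⟩ := h1
      apply h
      refine ⟨k, ?_⟩
      have h2 : ((n : ℝ) / q : ℂ) = k := by
        have h3 : (2 * Real.pi * Complex.I : ℂ) ≠ 0 := Complex.two_pi_I_ne_zero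
        apply mul_right_cancel₀ h3
        rw [← hk]; push_cast; ring
      have h4 : (n : ℝ) / q = k := by exact_mod_cast h2
      rw [div_eq_iff hq0] at h4
      have : n = k * q := by exact_mod_cast h4
      rw [this, mul_comm]
    have h1 := geom_sum_mul (phase ((n : ℝ) / q)) q
    rw [← phase_nat_mul, mul_div_cancel₀ _ hq0, phase_int, sub_self] at h1
    exact (mul_eq_zero.1 h1).resolve_right (sub_ne_zero.2 hne)

/-- A bounded periodic factor can be removed from an exponential sum at the expense of a
rational shift of the linear term: this is the Fourier expansion modulo the period. -/
lemma exists_norm_sum_mul_periodic_le {φ : ℕ → ℂ} {q : ℕ} (hq : 1 ≤ q)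
    (hper : Function.Periodic φ q) (hφ : ∀ m, ‖φ m‖ ≤ 1) (x : ℕ → ℝ) (s : Finset ℕ) :
    ∃ t : ℕ, ‖∑ m ∈ s, phase (x m) * φ m‖ ≤ q * ‖∑ m ∈ s, phase (x m + t / q * m)‖ := by
  have hq0 : (q : ℂ) ≠ 0 := by exact_mod_cast (by omega : q ≠ 0)
  set c : ℕ → ℂ := fun t => (q : ℂ)⁻¹ * ∑ r ∈ Finset.range q, φ r * phase (-(t / q * r)) with hc
  have hc1 : ∀ t, ‖c t‖ ≤ 1 := by
    intro t
    rw [hc, norm_mul, norm_inv, Complex.norm_natCast]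
    have h1 : ‖∑ r ∈ Finset.range q, φ r * phase (-(t / q * r))‖ ≤ q := by
      refine (norm_sum_le _ _).trans ?_
      refine (Finset.sum_le_card_nsmul _ _ 1 fun r _ => ?_).trans (by simp)
      rw [norm_mul, norm_phase, mul_one]
      exact hφ r
    rw [inv_mul_le_iff₀ (by exact_mod_cast hq), mul_one]
    exact h1
  have hexp : ∀ m, φ m = ∑ t ∈ Finset.range q, c t * phase (t / q * m) := by
    intro m
    have h1 : ∀ t ∈ Finset.range q, c t * phase (t / q * m) =
        ∑ r ∈ Finset.range q, (q : ℂ)⁻¹ * φ r * phase (t * ((((m : ℤ) - r : ℤ) : ℝ) / q)) := by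
      intro t _
      rw [hc, mul_assoc, Finset.sum_mul, Finset.mul_sum]
      refine Finset.sum_congr rfl fun r _ => ?_
      rw [mul_assoc (φ r), ← phase_add, mul_assoc]
      congr 3
      push_cast
      ring
    rw [Finset.sum_congr rfl h1, Finset.sum_comm]
    simp_rw [← Finset.mul_sum, sum_range_phase_div hq]
    have hmod := Nat.mod_lt m (show q > 0 by omega)
    rw [Finset.sum_eq_single (m % q)]
    · rw [if_pos, hper.map_mod_nat m, mul_right_comm, inv_mul_cancel₀ hq0, one_mul]
      have := Nat.div_add_mod m q
      exact ⟨(m / q : ℕ), by zify at this ⊢; linarith⟩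
    · intro r hr hne
      rw [if_neg, mul_zero]
      intro hdvd
      apply hne
      have hr' := Finset.mem_range.1 hr
      have h2 : r % q = m % q := (Nat.modEq_iff_dvd.2 hdvd)
      rwa [Nat.mod_eq_of_lt hr'] at h2
    · intro h
      exact absurd (Finset.mem_range.2 hmod) h
  obtain ⟨t, -, ht⟩ := (Finset.range q).exists_max_image
    (fun t => ‖∑ m ∈ s, phase (x m + t / q * m)‖) ⟨0, Finset.mem_range.2 (by omega)⟩
  refine ⟨t, ?_⟩
  have e : ∑ m ∈ s, phase (x m) * φ m =
      ∑ t ∈ Finset.range q, c t * ∑ m ∈ s, phase (x m + t / q * m) := by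
    simp_rw [Finset.mul_sum]
    rw [Finset.sum_comm]
    refine Finset.sum_congr rfl fun m _ => ?_
    rw [hexp m, Finset.mul_sum]
    refine Finset.sum_congr rfl fun t _ => ?_
    rw [phase_add]; ring
  rw [e]
  refine (norm_sum_le _ _).trans ?_
  refine (Finset.sum_le_card_nsmul _ _ (‖∑ m ∈ s, phase (x m + t / q * m)‖) fun r hr => ?_).trans
    (by simp)
  rw [norm_mul]
  exact (mul_le_of_le_one_left (norm_nonneg _) (hc1 r)).trans (ht r hr)

/-- If `phase (f m)`, for a real polynomial `f` of degree at most `k + 1`, has a sum of size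
`M / R` over a subinterval of `[0, M)`, then a multiple of the linear coefficient of `f` by some
`q ≤ R ^ C` is within `R ^ C / M` of an integer. The higher coefficients of `f` are arbitrary:
the leading one is close to a rational with small denominator, so it only contributes a factor of
small total variation and a periodic factor, and the latter only shifts the linear coefficient by
a rational with small denominator. -/
theorem exists_coeff_one_near_int_of_large_sum (k : ℕ) : ∃ C : ℕ, ∀ (R : ℝ) (M a b : ℕ)
    (f : Polynomial ℝ), 2 ≤ R → 1 ≤ M → b ≤ M → f.natDegree ≤ k + 1 →
    (M : ℝ) ≤ R * ‖∑ m ∈ Finset.Ico a b, phase (f.eval (m : ℝ))‖ →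
    ∃ q : ℕ, 1 ≤ q ∧ (q : ℝ) ≤ R ^ C ∧ ∃ p : ℤ, |q * f.coeff 1 - p| ≤ R ^ C / (M : ℝ) := by
  induction k with
  | zero =>
    obtain ⟨C, hC⟩ := exists_near_int_of_large_sum_fwdDiff 0
    refine ⟨C, fun R M a b f hR hM hb hf hlarge => ?_⟩
    rw [Finset.sum_Ico_eq_sum_range] at hlarge
    have h := hC R M (b - a) (fun m => f.eval ((a + m : ℕ) : ℝ)) (f.coeff 1) hR hM (by omega)
      ((fwdDiff_iter_natCast f.eval a _).trans (by
        rw [fwdDiff_iter_eval_of_natDegree_le hf]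
        simp)) hlarge
    simpa using h
  | succ k ih =>
    obtain ⟨C, hC⟩ := ih
    obtain ⟨D, hD⟩ := exists_near_int_of_large_sum_fwdDiff (k + 1)
    set F := (k + 2).factorial with hF
    have hF1 : 1 ≤ F := Nat.factorial_pos _
    refine ⟨D + F + (4 + D + D + F) * C, fun R M a b f hR hM hb hf hlarge => ?_⟩
    have hM1 : (1 : ℝ) ≤ M := by exact_mod_cast hM
    have hM' : (0 : ℝ) < M := by linarith
    have hR1 : 1 ≤ R := by linarith
    have hab : a ≤ b := by
      by_contra hcon
      rw [Finset.Ico_eq_empty_of_le (by omega), Finset.sum_empty, norm_zero, mul_zero] at hlarge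
      linarith
    set c := f.coeff (k + 2) with hc
    set Q := R ^ D with hQ
    have hQ1 : 1 ≤ Q := one_le_pow₀ hR1
    obtain ⟨q, hq1, hqQ, p, hp⟩ := hD R M (b - a) (fun m => f.eval ((a + m : ℕ) : ℝ)) (F * c) hR hM
      (by omega) ((fwdDiff_iter_natCast f.eval a _).trans (by
        rw [fwdDiff_iter_eval_of_natDegree_le hf])) (by
        rwa [Finset.sum_Ico_eq_sum_range] at hlarge)
    set q₁ := q * F with hq₁
    have hq₁1 : 1 ≤ q₁ := Nat.mul_pos hq1 hF1
    have hq₁1' : (1 : ℝ) ≤ q₁ := by exact_mod_cast hq₁1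
    have hq₁0 : (q₁ : ℝ) ≠ 0 := by linarith
    have hq₁R : (q₁ : ℝ) ≤ R ^ (D + F) := by
      rw [hq₁, pow_add]; push_cast
      gcongr
      have : (F : ℝ) ≤ 2 ^ F := by exact_mod_cast Nat.lt_two_pow_self.le
      exact this.trans (by gcongr)
    -- the leading coefficient is `p / q₁ + θ`
    set θ : ℝ := c - p / q₁ with hθ
    have hθM : |θ| * (M : ℝ) ^ (k + 2) ≤ Q := by
      have e : q * (F * c) - p = q₁ * θ := by
        rw [hθ, mul_sub, mul_div_cancel₀ _ hq₁0, hq₁]; push_cast; ring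
      rw [e, abs_mul, Nat.abs_cast, le_div_iff₀ (by positivity)] at hp
      refine le_trans ?_ hp
      rw [mul_assoc]
      exact le_mul_of_one_le_left (by positivity) hq₁1'
    set g := f.erase (k + 2) with hg
    have hgf : ∀ x : ℝ, f.eval x = g.eval x + c * x ^ (k + 2) := by
      intro x
      conv_lhs => rw [← Polynomial.monomial_add_erase f (k + 2)]
      rw [Polynomial.eval_add, Polynomial.eval_monomial, add_comm]
    have hgdeg : g.natDegree ≤ k + 1 := by
      rw [Polynomial.natDegree_le_iff_coeff_eq_zero]
      intro N hN
      rw [hg, Polynomial.coeff_erase]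
      split_ifs with h
      · rfl
      · exact Polynomial.coeff_eq_zero_of_natDegree_lt (by omega)
    set φ : ℕ → ℂ := fun m => phase (p / q₁ * (m : ℝ) ^ (k + 2)) with hφ
    have hper : Function.Periodic φ q₁ := by
      intro m
      obtain ⟨j, hj⟩ : (q₁ : ℤ) ∣ ((m + q₁ : ℕ) : ℤ) ^ (k + 2) - (m : ℤ) ^ (k + 2) := by
        refine dvd_trans ?_ (sub_dvd_pow_sub_pow _ _ _)
        push_cast
        simp
      have hj' : ((m + q₁ : ℕ) : ℝ) ^ (k + 2) - (m : ℝ) ^ (k + 2) = q₁ * j := by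
        exact_mod_cast hj
      have e : (p : ℝ) / q₁ * ((m + q₁ : ℕ) : ℝ) ^ (k + 2) =
          p / q₁ * (m : ℝ) ^ (k + 2) + ((p * j : ℤ) : ℝ) := by
        rw [eq_add_of_sub_eq hj']
        push_cast
        field_simp
        ring
      change phase _ = phase _
      rw [e, phase_add, phase_int, mul_one]
    have hsplit : ∀ m ∈ Finset.Ico a b, phase (f.eval (m : ℝ)) =
        (phase (g.eval (m : ℝ)) * φ m) * phase (θ * (m : ℝ) ^ (k + 2)) := by
      intro m _
      rw [hφ, ← phase_add, ← phase_add, hgf, hθ]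
      congr 1; ring
    rw [Finset.sum_congr rfl hsplit] at hlarge
    obtain ⟨b', hb', hparts⟩ := exists_norm_sum_mul_le (fun m => phase (g.eval (m : ℝ)) * φ m)
      (fun m => phase (θ * (m : ℝ) ^ (k + 2))) hab (V := 7 * Q) (norm_phase _).le (by
        refine (sum_norm_phase_mul_pow_sub_le θ (k + 2) a b).trans ?_
        rw [mul_assoc]
        gcongr
        refine le_trans ?_ hθM
        gcongr)
    obtain ⟨t, ht⟩ := exists_norm_sum_mul_periodic_le hq₁1 hper (fun m => (norm_phase _).le)
      (fun m => g.eval (m : ℝ)) (Finset.Ico a b')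
    set G : Polynomial ℝ := g + Polynomial.C ((t : ℝ) / q₁) * Polynomial.X with hG
    have hGeval : ∀ x : ℝ, G.eval x = g.eval x + t / q₁ * x := by
      intro x; rw [hG]; simp
    have hGdeg : G.natDegree ≤ k + 1 := by
      refine (Polynomial.natDegree_add_le _ _).trans (max_le hgdeg ?_)
      exact (Polynomial.natDegree_C_mul_le _ _).trans (Polynomial.natDegree_X_le.trans (by omega))
    have hGcoeff : G.coeff 1 = f.coeff 1 + t / q₁ := by
      rw [hG, hg]; simp
    simp only [← hGeval] at ht
    obtain ⟨r, hr1, hrR, p', hp'⟩ := hC (R * (8 * Q) * q₁) M a b' G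
      (by
        have : 1 ≤ Q * q₁ := by nlinarith
        nlinarith) hM (hb'.trans hb) hGdeg (by
        calc (M : ℝ) ≤ R * _ := hlarge
          _ ≤ R * ((1 + 7 * Q) * ‖∑ m ∈ Finset.Ico a b', phase (g.eval (m : ℝ)) * φ m‖) := by
            gcongr
          _ ≤ R * ((8 * Q) * (q₁ * ‖∑ m ∈ Finset.Ico a b', phase (G.eval (m : ℝ))‖)) := by
            gcongr; linarith
          _ = _ := by ring)
    have hR' : R * (8 * Q) * q₁ ≤ R ^ (4 + D + D + F) := by
      have h8 : (2 : ℝ) ^ 3 ≤ R ^ 3 := by gcongr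
      calc R * (8 * Q) * q₁ ≤ R * (R ^ 3 * R ^ D) * R ^ (D + F) := by
            gcongr; linarith
        _ = _ := by ring
    have hfin : (q₁ : ℝ) * (R * (8 * Q) * q₁) ^ C ≤ R ^ (D + F + (4 + D + D + F) * C) := by
      rw [pow_add, pow_mul]
      gcongr
    refine ⟨r * q₁, Nat.mul_pos hr1 hq₁1, ?_, q₁ * p' - r * t, ?_⟩
    · push_cast
      rw [mul_comm]
      exact le_trans (by gcongr) hfin
    · have e : ((r * q₁ : ℕ) : ℝ) * f.coeff 1 - ((q₁ * p' - r * t : ℤ) : ℝ) =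
          q₁ * (r * G.coeff 1 - p') := by
        rw [hGcoeff]; push_cast; field_simp; ring
      rw [e, abs_mul, Nat.abs_cast]
      refine (mul_le_mul_of_nonneg_left hp' (by linarith)).trans ?_
      rw [← mul_div_assoc]
      gcongr

/-! ### Power saving for a non-Liouville linear coefficient -/

lemma NonLiouville.exists_lt_abs_mul_sub {α : ℝ} (hα : NonLiouville α) :
    ∃ A : ℕ, ∀ q : ℕ, 1 ≤ q → ∀ p : ℤ, 1 / (2 * q : ℝ) ^ A < |q * α - p| := by
  unfold NonLiouville IsLiouvilleOrRational at hα
  push Not at hα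
  obtain ⟨n, hn⟩ := hα
  refine ⟨n, fun q hq p => ?_⟩
  have hq' : (1 : ℝ) ≤ q := by exact_mod_cast hq
  -- doubling numerator and denominator makes the denominator exceed `1`
  have h1 := hn (2 * p) (2 * q) (by omega)
  push_cast at h1
  rw [mul_div_mul_left _ _ (two_ne_zero)] at h1
  refine h1.trans_le ?_
  have e : q * α - p = q * (α - p / q) := by field_simp
  rw [e, abs_mul, Nat.abs_cast]
  exact le_mul_of_one_le_left (abs_nonneg _) hq'

/-- Power saving in the sums of `phase (n * f m)`, uniform in all the coefficients of `f` except
the linear one. -/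
theorem NonLiouville.norm_sum_phase_le {α : ℝ} (hα : NonLiouville α) (k : ℕ) :
    ∃ c : ℝ, 0 < c ∧ c ≤ 1 ∧ ∀ (n M a b : ℕ) (f : Polynomial ℝ), 1 ≤ n → 1 ≤ M → b ≤ M →
      f.natDegree ≤ k + 1 → f.coeff 1 = α →
      ‖∑ m ∈ Finset.Ico a b, phase (n * f.eval (m : ℝ))‖ ≤
        4 * (M : ℝ) ^ (1 - c) * Real.sqrt n := by
  obtain ⟨A, hA⟩ := hα.exists_lt_abs_mul_sub
  obtain ⟨C, hC⟩ := exists_coeff_one_near_int_of_large_sum k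
  set B := max (C + A + C * A) (2 * A) + 1 with hB
  have hB1 : (1 : ℝ) ≤ B := by exact_mod_cast (by omega : 1 ≤ B)
  refine ⟨1 / B, by positivity, by rw [div_le_one (by linarith)]; exact hB1, ?_⟩
  intro n M a b f hn hM hb hf hcoeff
  by_contra! hcon
  have hM1 : (1 : ℝ) ≤ M := by exact_mod_cast hM
  have hM' : (0 : ℝ) < M := by linarith
  have hn1 : (1 : ℝ) ≤ n := by exact_mod_cast hn
  set w := Real.sqrt n with hw
  have hw1 : 1 ≤ w := Real.one_le_sqrt.2 hn1
  have hw2 : w ^ 2 = n := Real.sq_sqrt (by linarith)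
  set u := (M : ℝ) ^ (1 / (B : ℝ)) with hu
  have hu0 : 0 < u := Real.rpow_pos_of_pos hM' _
  have huB : u ^ B = M := by
    rw [hu, ← Real.rpow_natCast, ← Real.rpow_mul hM'.le, one_div_mul_cancel (by linarith),
      Real.rpow_one]
  rw [Real.rpow_sub hM', Real.rpow_one, ← hu] at hcon
  set S := ‖∑ m ∈ Finset.Ico a b, phase (n * f.eval (m : ℝ))‖
  have hSM : S ≤ M := by
    refine (norm_sum_le _ _).trans ?_
    simp only [norm_phase, Finset.sum_const, Nat.card_Ico, nsmul_eq_mul, mul_one]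
    exact_mod_cast (by omega : b - a ≤ M)
  -- the factor `2` makes the final comparison `M < M` strict
  set R := u / (2 * w) with hR
  have hRS : (M : ℝ) ≤ R * S := by
    have : R * (4 * (M / u) * w) ≤ R * S := by gcongr
    refine le_trans ?_ this
    have e : R * (4 * (M / u) * w) = 2 * M := by rw [hR]; field_simp; ring
    linarith
  have hR2 : 2 ≤ R := by
    rw [hR, le_div_iff₀ (by positivity)]
    have h1 : 4 * (M / u) * w < M := hcon.trans_le hSM
    have h2 : 4 * (M / u) * w = M * (4 * w / u) := by ring
    rw [h2] at h1
    have h3 : 4 * w / u < 1 := by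
      by_contra! h
      nlinarith
    rw [div_lt_one hu0] at h3
    linarith
  have hR1 : 1 ≤ R := by linarith
  obtain ⟨q, hq1, hqR, p, hp⟩ := hC R M a b (Polynomial.C (n : ℝ) * f) hR2 hM hb
    ((Polynomial.natDegree_C_mul_le _ _).trans hf) (by
      simp only [Polynomial.eval_mul, Polynomial.eval_C]; exact hRS)
  rw [Polynomial.coeff_C_mul, hcoeff] at hp
  have hlow := hA (q * n) (Nat.mul_pos hq1 hn) p
  have e : ((q * n : ℕ) : ℝ) * α - p = q * (n * α) - p := by push_cast; ring
  rw [e] at hlow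
  have h1 := hlow.trans_le hp
  have hq1' : (1 : ℝ) ≤ q := by exact_mod_cast hq1
  rw [div_lt_div_iff₀ (by push_cast; positivity) hM', one_mul] at h1
  have h2 : R ^ C * (2 * ((q * n : ℕ) : ℝ)) ^ A ≤ R ^ B * (2 * w) ^ B / 1 := by
    have hw2' : 1 ≤ 2 * w := by linarith
    calc R ^ C * (2 * ((q * n : ℕ) : ℝ)) ^ A ≤ R ^ C * (R * (R ^ C * w ^ 2)) ^ A := by
          push_cast; rw [hw2]; gcongr
      _ = R ^ (C + A + C * A) * w ^ (2 * A) := by ring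
      _ ≤ R ^ B * (2 * w) ^ B := by
          gcongr ?_ * ?_
          · exact pow_le_pow_right₀ hR1 (by omega)
          · calc w ^ (2 * A) ≤ (2 * w) ^ (2 * A) := by gcongr; linarith
              _ ≤ _ := pow_le_pow_right₀ hw2' (by omega)
      _ = _ := by rw [div_one]
  have h3 : R ^ B * (2 * w) ^ B = M := by
    rw [← mul_pow, hR, div_mul_cancel₀ _ (by positivity), huB]
  rw [div_one, h3] at h2
  linarith

/-! ### Discrepancy -/

/-- The periodic Bernoulli function `B₂({x})`. -/
noncomputable def periodicBernoulliTwo (x : ℝ) : ℝ := Int.fract x ^ 2 - Int.fract x + 1 / 6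

lemma hasSum_periodicBernoulliTwo (x : ℝ) :
    HasSum (fun n : ℕ => 1 / (n : ℝ) ^ 2 * (phase (n * x)).re)
      (Real.pi ^ 2 * periodicBernoulliTwo x) := by
  have h := hasSum_one_div_nat_pow_mul_cos one_ne_zero
    (x := Int.fract x) ⟨Int.fract_nonneg x, (Int.fract_lt_one x).le⟩
  convert! h using 1
  · funext n
    rw [phase_re]
    congr 1
    rw [← Int.self_sub_floor x, mul_sub]
    have e : 2 * Real.pi * n * x - 2 * Real.pi * n * ⌊x⌋ =
        2 * Real.pi * (n * x) - ((n * ⌊x⌋ : ℤ) : ℝ) * (2 * Real.pi) := by push_cast; ring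
    rw [e, Real.cos_sub_int_mul_two_pi]
  · rw [periodicBernoulliTwo, ← bernoulliFun, mul_one, bernoulliFun_two, Nat.factorial_two]
    push_cast
    ring

/-- The weight `√n` is admissible because `∑ n ^ (-2) * √n` converges. -/
lemma exists_abs_sum_periodicBernoulliTwo_le : ∃ Z : ℝ, 0 < Z ∧ ∀ (K : ℝ) (s : Finset ℕ)
    (x : ℕ → ℝ), (∀ n : ℕ, 1 ≤ n → ‖∑ m ∈ s, phase (n * x m)‖ ≤ K * Real.sqrt n) →
    ∀ t : ℝ, |∑ m ∈ s, periodicBernoulliTwo (x m + t)| ≤ Z * K := by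
  have hsum : Summable fun n : ℕ => 1 / (n : ℝ) ^ (3 / 2 : ℝ) :=
    Real.summable_one_div_nat_rpow.2 (by norm_num)
  refine ⟨∑' n : ℕ, 1 / (n : ℝ) ^ (3 / 2 : ℝ), ?_, fun K s x hx t => ?_⟩
  · exact hsum.tsum_pos (fun n => by positivity) 1 (by norm_num)
  have h1 : HasSum (fun n : ℕ => ∑ m ∈ s, 1 / (n : ℝ) ^ 2 * (phase (n * (x m + t))).re)
      (∑ m ∈ s, Real.pi ^ 2 * periodicBernoulliTwo (x m + t)) :=
    hasSum_sum fun m _ => hasSum_periodicBernoulliTwo (x m + t)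
  rw [← Finset.mul_sum] at h1
  have hterm : ∀ n : ℕ, ‖∑ m ∈ s, 1 / (n : ℝ) ^ 2 * (phase (n * (x m + t))).re‖ ≤
      K * (1 / (n : ℝ) ^ (3 / 2 : ℝ)) := by
    intro n
    rcases Nat.eq_zero_or_pos n with rfl | hn
    · simp
    have hn' : (0 : ℝ) < n := by exact_mod_cast hn
    have e : ∑ m ∈ s, 1 / (n : ℝ) ^ 2 * (phase (n * (x m + t))).re =
        1 / (n : ℝ) ^ 2 * (phase (n * t) * ∑ m ∈ s, phase (n * x m)).re := by
      rw [← Finset.mul_sum, Finset.mul_sum s _ (phase (n * t)), Complex.re_sum]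
      congr 1
      refine Finset.sum_congr rfl fun m _ => ?_
      rw [← phase_add]
      congr 2; ring
    rw [e, norm_mul, Real.norm_of_nonneg (by positivity), Real.norm_eq_abs]
    have h2 : |(phase (n * t) * ∑ m ∈ s, phase (n * x m)).re| ≤ K * Real.sqrt n := by
      refine (Complex.abs_re_le_norm _).trans ?_
      rw [norm_mul, norm_phase, one_mul]
      exact hx n hn
    have h3 : 1 / (n : ℝ) ^ 2 * Real.sqrt n = 1 / (n : ℝ) ^ (3 / 2 : ℝ) := by
      rw [Real.sqrt_eq_rpow, ← Real.rpow_two, one_div ((n : ℝ) ^ (2 : ℝ)),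
        one_div ((n : ℝ) ^ (3 / 2 : ℝ)), ← Real.rpow_neg hn'.le, ← Real.rpow_neg hn'.le,
        ← Real.rpow_add hn']
      norm_num
    calc _ ≤ 1 / (n : ℝ) ^ 2 * (K * Real.sqrt n) := by gcongr
      _ = K * (1 / (n : ℝ) ^ 2 * Real.sqrt n) := by ring
      _ = _ := by rw [h3]
  have h4 := tsum_of_norm_bounded (hsum.hasSum.mul_left K) hterm
  rw [h1.tsum_eq, Real.norm_eq_abs, abs_mul, abs_of_pos (by positivity)] at h4
  have hpi : 1 ≤ Real.pi ^ 2 := by nlinarith [Real.pi_gt_three]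
  rw [mul_comm]
  exact (le_mul_of_one_le_left (abs_nonneg _) hpi).trans h4

lemma fract_add_of_le_one (x : ℝ) {η : ℝ} (h0 : 0 ≤ η) (h1 : η ≤ 1) :
    (Int.fract (x + η) = Int.fract x + η ∧ Int.fract x + η < 1) ∨
      (Int.fract (x + η) = Int.fract x + η - 1 ∧ 1 ≤ Int.fract x + η) := by
  have ha := Int.fract_nonneg x
  have hb := Int.fract_lt_one x
  rcases lt_or_ge (Int.fract x + η) 1 with h | h
  · refine Or.inl ⟨Int.fract_eq_iff.2 ⟨by linarith, h, ⌊x⌋, ?_⟩, h⟩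
    rw [← Int.self_sub_floor]; ring
  · refine Or.inr ⟨Int.fract_eq_iff.2 ⟨by linarith, by linarith, ⌊x⌋ + 1, ?_⟩, h⟩
    rw [← Int.self_sub_floor]; push_cast; ring

/-- The sawtooth `{x} - 1/2` has slope `1` and downward jumps, so that it exceeds its average over
`[x, x + η]` by at least `-η / 2`. -/
lemma periodicBernoulliTwo_add_sub_le (x : ℝ) {η : ℝ} (h0 : 0 ≤ η) (h1 : η ≤ 1) :
    periodicBernoulliTwo (x + η) - periodicBernoulliTwo x ≤
      2 * η * (Int.fract x - 1 / 2) + η ^ 2 := by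
  unfold periodicBernoulliTwo
  rcases fract_add_of_le_one x h0 h1 with ⟨e, h⟩ | ⟨e, h⟩ <;> rw [e] <;> nlinarith

lemma le_periodicBernoulliTwo_sub (x : ℝ) {η : ℝ} (h0 : 0 ≤ η) (h1 : η ≤ 1) :
    2 * η * (Int.fract x - 1 / 2) - η ^ 2 ≤
      periodicBernoulliTwo x - periodicBernoulliTwo (x - η) := by
  unfold periodicBernoulliTwo
  have ha := Int.fract_nonneg (x - η)
  have hb := Int.fract_lt_one (x - η)
  have := fract_add_of_le_one (x - η) h0 h1
  rw [sub_add_cancel] at this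
  rcases this with ⟨e, h⟩ | ⟨e, h⟩ <;> rw [e] <;> nlinarith

lemma abs_sum_fract_sub_half_le {s : Finset ℕ} {x : ℕ → ℝ} {D η : ℝ}
    (hD : ∀ t : ℝ, |∑ m ∈ s, periodicBernoulliTwo (x m + t)| ≤ D) (h0 : 0 < η) (h1 : η ≤ 1)
    (t : ℝ) : |∑ m ∈ s, (Int.fract (x m + t) - 1 / 2)| ≤ D / η + η * s.card := by
  have hlow : ∑ m ∈ s, (periodicBernoulliTwo (x m + t + η) - periodicBernoulliTwo (x m + t)) ≤
      ∑ m ∈ s, (2 * η * (Int.fract (x m + t) - 1 / 2) + η ^ 2) :=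
    Finset.sum_le_sum fun m _ => periodicBernoulliTwo_add_sub_le _ h0.le h1
  have hup : ∑ m ∈ s, (2 * η * (Int.fract (x m + t) - 1 / 2) + -η ^ 2) ≤
      ∑ m ∈ s, (periodicBernoulliTwo (x m + t) - periodicBernoulliTwo (x m + t - η)) :=
    Finset.sum_le_sum fun m _ => by
      rw [← sub_eq_add_neg]
      exact le_periodicBernoulliTwo_sub _ h0.le h1
  rw [Finset.sum_add_distrib, ← Finset.mul_sum, Finset.sum_const, Finset.sum_sub_distrib,
    nsmul_eq_mul] at hlow
  rw [Finset.sum_add_distrib, ← Finset.mul_sum, Finset.sum_const,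
    Finset.sum_sub_distrib (fun m => periodicBernoulliTwo (x m + t)), nsmul_eq_mul] at hup
  have d1 := abs_le.1 (hD t)
  have d2 := abs_le.1 (hD (t + η))
  have d3 := abs_le.1 (hD (t - η))
  simp only [← add_assoc] at d2
  simp only [← add_sub_assoc] at d3
  set V := ∑ m ∈ s, (Int.fract (x m + t) - 1 / 2)
  have hcard : (0 : ℝ) ≤ s.card := Nat.cast_nonneg _
  have key : η * |V| ≤ D + η * (η * s.card) := by
    rw [← abs_of_pos h0, ← abs_mul, abs_of_pos h0, abs_le]
    constructor <;> nlinarith [mul_nonneg (sq_nonneg η) hcard]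
  have e : D / η + η * s.card = (D + η * (η * s.card)) / η := by field_simp
  rw [e, le_div_iff₀ h0]
  linarith

/-- The indicator function of `{x} < δ` is `δ` plus a difference of two values of the
sawtooth. -/
lemma ite_fract_lt_eq (x : ℝ) {δ : ℝ} (h0 : 0 ≤ δ) (h1 : δ ≤ 1) :
    (if Int.fract x < δ then (1 : ℝ) else 0) = δ + Int.fract (x - δ) - Int.fract x := by
  have ha := Int.fract_nonneg (x - δ)
  have hb := Int.fract_lt_one (x - δ)
  have := fract_add_of_le_one (x - δ) h0 h1
  rw [sub_add_cancel] at this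
  rcases this with ⟨e, h⟩ | ⟨e, h⟩
  · rw [if_neg (by linarith), e]; ring
  · rw [if_pos (by linarith), e]; ring

/-- Equidistribution modulo `1`, with a power saving that is uniform in all coefficients of `f`
except the linear one. -/
theorem NonLiouville.abs_card_fract_lt_sub_le {α : ℝ} (hα : NonLiouville α) (k : ℕ) :
    ∃ K c : ℝ, 0 < K ∧ 0 < c ∧ c < 1 ∧ ∀ (M : ℕ) (f : Polynomial ℝ) (δ : ℝ), 0 ≤ δ → δ ≤ 1 →
      f.natDegree ≤ k + 1 → f.coeff 1 = α →
      |(((Finset.Icc 1 M).filter fun m : ℕ => Int.fract (f.eval (m : ℝ)) < δ).card : ℝ) - M * δ| ≤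
        K * (M : ℝ) ^ (1 - c) := by
  obtain ⟨c, hc0, hc1, hc⟩ := hα.norm_sum_phase_le k
  obtain ⟨Z, hZ, hψ⟩ := exists_abs_sum_periodicBernoulliTwo_le
  refine ⟨2 * (8 * Z + 1), c / 2, by positivity, by positivity, by linarith, ?_⟩
  intro M f δ hδ0 hδ1 hf hcoeff
  rcases Nat.eq_zero_or_pos M with rfl | hM
  · simp [Real.zero_rpow (show (1 : ℝ) - c / 2 ≠ 0 by linarith)]
  have hM1 : (1 : ℝ) ≤ M := by exact_mod_cast hM
  have hM' : (0 : ℝ) < M := by linarith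
  set s := Finset.Icc 1 M with hs
  have hscard : (s.card : ℝ) = M := by rw [hs, Nat.card_Icc, Nat.add_sub_cancel]
  have hexp : ∀ n : ℕ, 1 ≤ n → ‖∑ m ∈ s, phase (n * f.eval (m : ℝ))‖ ≤
      (8 * (M : ℝ) ^ (1 - c)) * Real.sqrt n := by
    intro n hn
    have h1 := hc n (M + 1) 1 (M + 1) f hn (by omega) le_rfl hf hcoeff
    have e : Finset.Ico 1 (M + 1) = s := rfl
    rw [e] at h1
    refine h1.trans ?_
    gcongr ?_ * _
    have h2 : ((M + 1 : ℕ) : ℝ) ^ (1 - c) ≤ (2 * M : ℝ) ^ (1 - c) := by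
      refine Real.rpow_le_rpow (by positivity) ?_ (by linarith)
      push_cast; linarith
    have h3 : (2 * M : ℝ) ^ (1 - c) ≤ 2 * (M : ℝ) ^ (1 - c) := by
      rw [Real.mul_rpow (by norm_num) hM'.le]
      gcongr
      calc (2 : ℝ) ^ (1 - c) ≤ 2 ^ (1 : ℝ) :=
            Real.rpow_le_rpow_of_exponent_le (by norm_num) (by linarith)
        _ = 2 := Real.rpow_one 2
    linarith
  have hD := hψ (8 * (M : ℝ) ^ (1 - c)) s (fun m => f.eval (m : ℝ)) hexp
  -- the choice of `η` balances the two terms of the smoothing bound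
  set η := (M : ℝ) ^ (-(c / 2)) with hη
  have hη0 : 0 < η := Real.rpow_pos_of_pos hM' _
  have hη1 : η ≤ 1 := Real.rpow_le_one_of_one_le_of_nonpos hM1 (by linarith)
  have hsaw : ∀ t : ℝ, |∑ m ∈ s, (Int.fract (f.eval (m : ℝ) + t) - 1 / 2)| ≤
      (8 * Z + 1) * (M : ℝ) ^ (1 - c / 2) := by
    intro t
    refine (abs_sum_fract_sub_half_le hD hη0 hη1 t).trans (le_of_eq ?_)
    have e1 : (M : ℝ) ^ (1 - c) / η = (M : ℝ) ^ (1 - c / 2) := by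
      rw [hη, ← Real.rpow_sub hM']; congr 1; ring
    have e2 : η * M = (M : ℝ) ^ (1 - c / 2) := by
      rw [hη, ← Real.rpow_add_one hM'.ne']; congr 1; ring
    rw [hscard, e2, ← mul_assoc, mul_div_assoc, e1]; ring
  have hcount : ((s.filter fun m : ℕ => Int.fract (f.eval (m : ℝ)) < δ).card : ℝ) - M * δ =
      ∑ m ∈ s, (Int.fract (f.eval (m : ℝ) + -δ) - 1 / 2) -
        ∑ m ∈ s, (Int.fract (f.eval (m : ℝ) + 0) - 1 / 2) := by
    rw [Finset.card_filter]
    push_cast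
    simp only [ite_fract_lt_eq _ hδ0 hδ1]
    rw [← hscard, ← nsmul_eq_mul, ← Finset.sum_const, ← Finset.sum_sub_distrib,
      ← Finset.sum_sub_distrib]
    refine Finset.sum_congr rfl fun m _ => ?_
    rw [add_zero, ← sub_eq_add_neg]; ring
  rw [hcount]
  refine (abs_sub _ _).trans ?_
  linarith [hsaw (-δ), hsaw 0]

/-! ### Common divisors of `x` and `⌊P x⌋` -/

/-- The number of `x` in `[1, N]` such that `d` divides both `x` and `⌊P x⌋`. -/
noncomputable def commonDivisorCount (P : Polynomial ℝ) (N d : ℕ) : ℕ :=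
  ((Finset.Icc 1 N).filter fun x : ℕ => d ∣ x ∧ (d : ℤ) ∣ ⌊P.eval (x : ℝ)⌋).card

lemma natCast_dvd_floor_iff {d : ℕ} (hd : 1 ≤ d) (y : ℝ) :
    (d : ℤ) ∣ ⌊y⌋ ↔ Int.fract (y / d) < 1 / d := by
  have hd' : (0 : ℝ) < d := by exact_mod_cast hd
  constructor
  · rintro ⟨j, hj⟩
    have h1 := (Int.floor_eq_iff.1 hj)
    push_cast at h1
    have h2 : ⌊y / d⌋ = j := by
      have hd1 : (1 : ℝ) ≤ d := by exact_mod_cast hd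
      rw [Int.floor_eq_iff, le_div_iff₀ hd', div_lt_iff₀ hd']
      constructor <;> nlinarith
    rw [← Int.self_sub_floor, h2, lt_div_iff₀ hd', sub_mul, div_mul_cancel₀ _ hd'.ne']
    linarith
  · intro h
    refine ⟨⌊y / d⌋, ?_⟩
    rw [← Int.self_sub_floor, lt_div_iff₀ hd', sub_mul, div_mul_cancel₀ _ hd'.ne'] at h
    have h1 := Int.floor_le (y / d)
    rw [le_div_iff₀ hd'] at h1
    rw [Int.floor_eq_iff]
    push_cast
    constructor <;> linarith

lemma commonDivisorCount_eq (P : Polynomial ℝ) (N : ℕ) {d : ℕ} (hd : 1 ≤ d) :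
    commonDivisorCount P N d = ((Finset.Icc 1 (N / d)).filter fun m : ℕ =>
      Int.fract ((Polynomial.C (1 / (d : ℝ)) * P.comp (Polynomial.C (d : ℝ) * Polynomial.X)).eval
        (m : ℝ)) < 1 / d).card := by
  have heval : ∀ m : ℕ,
      (Polynomial.C (1 / (d : ℝ)) * P.comp (Polynomial.C (d : ℝ) * Polynomial.X)).eval (m : ℝ) =
        P.eval ((d * m : ℕ) : ℝ) / d := by
    intro m
    simp only [Polynomial.eval_mul, Polynomial.eval_C, Polynomial.eval_comp, Polynomial.eval_X]
    push_cast
    ring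
  simp only [heval, ← natCast_dvd_floor_iff hd]
  rw [← Finset.card_image_of_injective _ (mul_right_injective₀ (show d ≠ 0 by omega)),
    commonDivisorCount]
  congr 1
  ext x
  simp only [Finset.mem_filter, Finset.mem_Icc, Finset.mem_image]
  constructor
  · rintro ⟨⟨h1, h2⟩, ⟨m, rfl⟩, h3⟩
    refine ⟨m, ⟨⟨Nat.pos_of_ne_zero ?_, ?_⟩, h3⟩, rfl⟩
    · rintro rfl; omega
    · rw [Nat.le_div_iff_mul_le hd, mul_comm]; exact h2
  · rintro ⟨m, ⟨⟨h1, h2⟩, h3⟩, rfl⟩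
    refine ⟨⟨Nat.mul_pos hd h1, ?_⟩, dvd_mul_right _ _, h3⟩
    rw [Nat.le_div_iff_mul_le hd, mul_comm] at h2; exact h2

lemma commonDivisorCount_le (P : Polynomial ℝ) (N : ℕ) {d : ℕ} (hd : 1 ≤ d) :
    commonDivisorCount P N d ≤ N / d := by
  rw [commonDivisorCount_eq P N hd]
  refine (Finset.card_filter_le _ _).trans ?_
  rw [Nat.card_Icc, Nat.add_sub_cancel]

/-- The error term is uniform in `d` because the linear coefficient of `P (d * X) / d` does not
depend on `d`. -/
theorem NonLiouville.abs_commonDivisorCount_sub_le {P : Polynomial ℝ}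
    (hP : NonLiouville (P.coeff 1)) : ∃ K c : ℝ, 0 < K ∧ 0 < c ∧ c < 1 ∧
      ∀ N d : ℕ, 1 ≤ d → d ≤ N →
      |(commonDivisorCount P N d : ℝ) - N / (d : ℝ) ^ 2| ≤ K * ((N : ℝ) / d) ^ (1 - c) := by
  obtain ⟨K, c, hK, hc0, hc1, h⟩ := hP.abs_card_fract_lt_sub_le P.natDegree
  refine ⟨K + 1, c, by linarith, hc0, hc1, fun N d hd hdN => ?_⟩
  have hd1 : (1 : ℝ) ≤ d := by exact_mod_cast hd
  have hd' : (0 : ℝ) < d := by linarith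
  have h1 := h (N / d) (Polynomial.C (1 / (d : ℝ)) * P.comp (Polynomial.C (d : ℝ) * Polynomial.X))
    (1 / d) (by positivity) (by rw [div_le_one hd']; exact hd1) (by
      refine (Polynomial.natDegree_C_mul_le _ _).trans ?_
      refine Polynomial.natDegree_comp_le.trans ?_
      have : (Polynomial.C (d : ℝ) * Polynomial.X).natDegree ≤ 1 :=
        (Polynomial.natDegree_C_mul_le _ _).trans Polynomial.natDegree_X_le
      nlinarith) (by
      rw [Polynomial.coeff_C_mul, Polynomial.comp_C_mul_X_coeff, pow_one]
      field_simp)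
  rw [← commonDivisorCount_eq P N hd] at h1
  have hfl : ((N / d : ℕ) : ℝ) ≤ N / d := Nat.cast_div_le
  have hfl2 : (N : ℝ) / d < ((N / d : ℕ) : ℝ) + 1 := by
    rw [div_lt_iff₀ hd']
    have e1 := Nat.div_add_mod N d
    have e2 := Nat.mod_lt N hd
    have e3 : N < (N / d + 1) * d := by linarith
    exact_mod_cast e3
  have h2 : (((N / d : ℕ) : ℝ)) ^ (1 - c) ≤ ((N : ℝ) / d) ^ (1 - c) :=
    Real.rpow_le_rpow (by positivity) hfl (by linarith)
  have h3 : 1 ≤ ((N : ℝ) / d) ^ (1 - c) := by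
    refine Real.one_le_rpow ?_ (by linarith)
    rw [le_div_iff₀ hd', one_mul]
    exact_mod_cast hdN
  have h4 : |((N / d : ℕ) : ℝ) * (1 / d) - N / (d : ℝ) ^ 2| ≤ 1 := by
    have e : ((N / d : ℕ) : ℝ) * (1 / d) - N / (d : ℝ) ^ 2 =
        -(((N : ℝ) / d - ((N / d : ℕ) : ℝ)) / d) := by field_simp; ring
    rw [e, abs_neg, abs_of_nonneg (div_nonneg (by linarith) hd'.le), div_le_one hd']
    linarith
  refine (abs_sub_le _ (((N / d : ℕ) : ℝ) * (1 / d)) _).trans ?_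
  have h5 := mul_le_mul_of_nonneg_left h2 hK.le
  rw [add_mul]
  linarith

/-! ### Sums over divisors -/

lemma sum_inv_sq_le_of_lt (D : Finset ℕ) (z : ℕ) (hD : ∀ d ∈ D, z < d) :
    ∑ d ∈ D, ((d : ℝ) ^ 2)⁻¹ ≤ 2 / (z + 1) := by
  refine le_trans ?_ (sum_Ioo_inv_sq_le (α := ℝ) z (D.sup id + 1))
  refine Finset.sum_le_sum_of_subset_of_nonneg (fun d hd => ?_) fun _ _ _ => by positivity
  exact Finset.mem_Ioo.2 ⟨hD d hd, Nat.lt_succ_of_le (Finset.le_sup (f := id) hd)⟩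

lemma hasSum_moebius_div_sq :
    HasSum (fun d : ℕ => (ArithmeticFunction.moebius d : ℝ) * ((d : ℝ) ^ 2)⁻¹)
      (6 / Real.pi ^ 2) := by
  have h2 : (1 : ℝ) < (2 : ℂ).re := by norm_num
  have h1 := (ArithmeticFunction.LSeriesSummable_moebius_iff.2 h2).LSeriesHasSum
  have hval : LSeries (fun n => ((ArithmeticFunction.moebius n : ℤ) : ℂ)) 2 =
      ((6 / Real.pi ^ 2 : ℝ) : ℂ) := by
    have h3 := ArithmeticFunction.LSeries_zeta_mul_Lseries_moebius h2
    rw [ArithmeticFunction.LSeries_zeta_eq_riemannZeta h2, riemannZeta_two] at h3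
    have hpi : (Real.pi : ℂ) ≠ 0 := by exact_mod_cast Real.pi_ne_zero
    rw [eq_comm, ← mul_right_inj' (show (Real.pi : ℂ) ^ 2 / 6 ≠ 0 from
      div_ne_zero (pow_ne_zero 2 hpi) (by norm_num)), h3]
    push_cast
    field_simp
  rw [LSeriesHasSum, hval] at h1
  rw [← Complex.hasSum_ofReal]
  convert! h1 using 1
  funext d
  rcases Nat.eq_zero_or_pos d with rfl | hd
  · simp
  · rw [LSeries.term_of_ne_zero (by omega)]
    push_cast
    rw [div_eq_mul_inv]
    congr 2
    exact_mod_cast (Complex.cpow_natCast (d : ℂ) 2).symm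

/-- The Euler product of `1 / ζ(2)` truncated at `z`, expanded as a sum over divisors. -/
lemma abs_sum_divisors_primorial_sub_le (z : ℕ) :
    |(∑ d ∈ (primorial z).divisors, (ArithmeticFunction.moebius d : ℝ) * ((d : ℝ) ^ 2)⁻¹) -
      6 / Real.pi ^ 2| ≤ (2 : ℝ) / (z + 1) := by
  set f : ℕ → ℝ := fun d => (ArithmeticFunction.moebius d : ℝ) * ((d : ℝ) ^ 2)⁻¹ with hf
  set D := (primorial z).divisors with hD
  have hf1 : ∀ d, |f d| ≤ ((d : ℝ) ^ 2)⁻¹ := by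
    intro d
    have h0 : 0 ≤ ((d : ℝ) ^ 2)⁻¹ := by positivity
    rw [hf, abs_mul, abs_of_nonneg h0]
    refine mul_le_of_le_one_left h0 ?_
    exact_mod_cast ArithmeticFunction.abs_moebius_le_one (n := d)
  have hf0 : ∀ d, d ∉ D → ¬ z < d → f d = 0 := by
    intro d hd hdz
    have hsq : ¬ Squarefree d := fun hsq => hd (Nat.mem_divisors.2
      ⟨hsq.dvd_primorial.trans (primorial_dvd_primorial (not_lt.1 hdz)), primorial_ne_zero z⟩)
    simp [hf, ArithmeticFunction.moebius_eq_zero_of_not_squarefree hsq]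
  have hlim : Tendsto (fun s : Finset ℕ => |∑ d ∈ D, f d - ∑ d ∈ s, f d|) atTop
      (𝓝 |∑ d ∈ D, f d - 6 / Real.pi ^ 2|) :=
    (tendsto_const_nhds.sub (by simpa [HasSum] using hasSum_moebius_div_sq)).abs
  refine le_of_tendsto hlim (eventually_atTop.2 ⟨D, fun s hs => ?_⟩)
  rw [abs_sub_comm, ← Finset.sum_sdiff hs, add_sub_cancel_right,
    ← Finset.sum_filter_of_ne (p := fun d => z < d)]
  · refine (Finset.abs_sum_le_sum_abs _ _).trans ((Finset.sum_le_sum fun d _ => hf1 d).trans ?_)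
    exact sum_inv_sq_le_of_lt _ z fun d hd => (Finset.mem_filter.1 hd).2
  · intro d hd hne
    by_contra hz
    exact hne (hf0 d (Finset.mem_sdiff.1 hd).2 hz)

lemma sum_divisors_moebius (n : ℕ) :
    ∑ d ∈ n.divisors, ArithmeticFunction.moebius d = if n = 1 then 1 else 0 := by
  rw [← ArithmeticFunction.coe_mul_zeta_apply, ArithmeticFunction.moebius_mul_coe_zeta,
    ArithmeticFunction.one_apply]

lemma dvd_intGcd_iff (d x : ℕ) (y : ℤ) : d ∣ Int.gcd x y ↔ d ∣ x ∧ (d : ℤ) ∣ y := by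
  rw [Int.gcd, Nat.dvd_gcd_iff, Int.natAbs_natCast, Int.natCast_dvd]

lemma sum_Icc_rpow_sub_one_le {c : ℝ} (hc0 : 0 < c) (hc1 : c ≤ 1) (D : ℕ) :
    ∑ d ∈ Finset.Icc 1 D, (d : ℝ) ^ (c - 1) ≤ (D : ℝ) ^ c / c := by
  induction D with
  | zero => simp [Real.zero_rpow hc0.ne']
  | succ D ih =>
    rw [Finset.sum_Icc_succ_top (by omega)]
    refine (add_le_add_left ih _).trans ?_
    set y : ℝ := ((D + 1 : ℕ) : ℝ) with hy
    have hy1 : 1 ≤ y := by rw [hy]; push_cast; linarith [Nat.cast_nonneg (α := ℝ) D]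
    have hy0 : 0 < y := by linarith
    have hD : (D : ℝ) = y * (1 + -y⁻¹) := by
      rw [mul_add, mul_neg, mul_inv_cancel₀ hy0.ne', hy]; push_cast; ring
    have hinv : y⁻¹ ≤ 1 := inv_le_one_of_one_le₀ hy1
    have h1 : (D : ℝ) ^ c ≤ y ^ c * (1 + c * -y⁻¹) := by
      rw [hD, Real.mul_rpow hy0.le (by linarith)]
      gcongr
      exact rpow_one_add_le_one_add_mul_self (by linarith) hc0.le hc1
    rw [Real.rpow_sub_one hy0.ne', le_div_iff₀ hc0, add_mul, div_mul_cancel₀ _ hc0.ne']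
    refine (add_le_add_left h1 _).trans (le_of_eq ?_)
    field_simp
    ring

/-! ### The sieve -/

/-- The number of `x` in `[1, N]` such that `x` and `⌊P x⌋` have no common prime factor `p ≤ z`. -/
noncomputable def siftedCount (P : Polynomial ℝ) (N z : ℕ) : ℕ :=
  ((Finset.Icc 1 N).filter fun x : ℕ =>
    Nat.gcd (Int.gcd (x : ℤ) ⌊P.eval (x : ℝ)⌋) (primorial z) = 1).card

lemma siftedCount_eq_sum (P : Polynomial ℝ) (N z : ℕ) :
    (siftedCount P N z : ℤ) = ∑ d ∈ (primorial z).divisors,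
      ArithmeticFunction.moebius d * (commonDivisorCount P N d : ℤ) := by
  have h1 : ∀ x : ℕ, (if Nat.gcd (Int.gcd (x : ℤ) ⌊P.eval (x : ℝ)⌋) (primorial z) = 1
      then (1 : ℤ) else 0) = ∑ d ∈ (primorial z).divisors, ArithmeticFunction.moebius d *
        (if d ∣ x ∧ (d : ℤ) ∣ ⌊P.eval (x : ℝ)⌋ then 1 else 0) := by
    intro x
    rw [← sum_divisors_moebius]
    simp_rw [mul_ite, mul_one, mul_zero]
    rw [← Finset.sum_filter]
    refine Finset.sum_congr ?_ fun _ _ => rfl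
    ext d
    rw [Nat.mem_divisors, Finset.mem_filter, Nat.mem_divisors, Nat.dvd_gcd_iff, dvd_intGcd_iff]
    have h0 := primorial_ne_zero z
    have h2 : Nat.gcd (Int.gcd (x : ℤ) ⌊P.eval (x : ℝ)⌋) (primorial z) ≠ 0 :=
      Nat.gcd_ne_zero_right h0
    tauto
  rw [siftedCount, Finset.card_filter]
  push_cast
  rw [Finset.sum_congr rfl fun x _ => h1 x, Finset.sum_comm]
  refine Finset.sum_congr rfl fun d _ => ?_
  rw [← Finset.mul_sum, commonDivisorCount, Finset.card_filter]
  push_cast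
  rfl

lemma coprimeCount_natCast_le_siftedCount (P : Polynomial ℝ) (N z : ℕ) :
    coprimeCount P N ≤ siftedCount P N z := by
  rw [coprimeCount, siftedCount, Nat.floor_natCast]
  refine Finset.card_le_card fun x hx => ?_
  rw [Finset.mem_filter] at hx ⊢
  exact ⟨hx.1, by rw [hx.2, Nat.gcd_one_left]⟩

/-- Elements that survive the sieve but are not coprime to the floor share a large prime with
it. -/
lemma siftedCount_le (P : Polynomial ℝ) (N z : ℕ) :
    siftedCount P N z ≤ coprimeCount P N +
      ∑ p ∈ (Finset.Icc 1 N).filter fun p => p.Prime ∧ z < p, commonDivisorCount P N p := by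
  rw [coprimeCount, siftedCount, Nat.floor_natCast]
  simp only [commonDivisorCount]
  refine le_trans (Finset.card_le_card ?_) ((Finset.card_union_le _ _).trans
    (Nat.add_le_add_left Finset.card_biUnion_le _))
  intro x hx
  rw [Finset.mem_filter] at hx
  obtain ⟨hxN, hgcd⟩ := hx
  rw [Finset.mem_union, Finset.mem_filter, Finset.mem_biUnion]
  by_cases h : Int.gcd (x : ℤ) ⌊P.eval (x : ℝ)⌋ = 1
  · exact Or.inl ⟨hxN, h⟩
  · obtain ⟨p, hp, hpg⟩ := Nat.exists_prime_and_dvd h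
    have hpx := (dvd_intGcd_iff _ _ _).1 hpg
    have hx1 := Finset.mem_Icc.1 hxN
    refine Or.inr ⟨p, Finset.mem_filter.2 ⟨Finset.mem_Icc.2 ⟨hp.one_le, ?_⟩, hp, ?_⟩,
      Finset.mem_filter.2 ⟨hxN, hpx⟩⟩
    · exact (Nat.le_of_dvd hx1.1 hpx.1).trans hx1.2
    · by_contra hz
      have : p ∣ 1 := hgcd ▸ Nat.dvd_gcd hpg (hp.dvd_primorial_iff.2 (not_lt.1 hz))
      exact hp.one_lt.ne' (Nat.dvd_one.1 this)

/-- The sieve bound. Primes up to `z` are sieved exactly, primes between `z` and `N / T` are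
discarded by equidistribution, and primes above `N / T` by their scarcity. -/
theorem NonLiouville.abs_coprimeCount_natCast_sub_le {P : Polynomial ℝ}
    (hP : NonLiouville (P.coeff 1)) : ∃ K c : ℝ, 0 < K ∧ 0 < c ∧ c < 1 ∧
      ∀ (N z : ℕ) (T : ℝ), 1 ≤ N → 1 ≤ T → 4 ^ z ≤ N →
      |(coprimeCount P N : ℝ) - N * (6 / Real.pi ^ 2)| ≤
        K * (4 ^ z * (N : ℝ) ^ (1 - c) + N / (z + 1) + N * T ^ (-c) + T * N.primeCounting) := by
  obtain ⟨K, c, hK, hc0, hc1, hcd⟩ := hP.abs_commonDivisorCount_sub_le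
  refine ⟨K + K / c + 4, c, by positivity, hc0, hc1, fun N z T hN hT hz => ?_⟩
  have hN1 : (1 : ℝ) ≤ N := by exact_mod_cast hN
  have hN0 : (0 : ℝ) < N := by linarith
  have hT0 : 0 < T := by linarith
  -- the sifted set
  have hsift : |(siftedCount P N z : ℝ) - N * (6 / Real.pi ^ 2)| ≤
      K * (4 ^ z * (N : ℝ) ^ (1 - c)) + 2 * (N / (z + 1)) := by
    have e : (siftedCount P N z : ℝ) = ∑ d ∈ (primorial z).divisors,
        (ArithmeticFunction.moebius d : ℝ) * (commonDivisorCount P N d : ℝ) := by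
      exact_mod_cast siftedCount_eq_sum P N z
    have e2 : (siftedCount P N z : ℝ) - N * (6 / Real.pi ^ 2) =
        ∑ d ∈ (primorial z).divisors, (ArithmeticFunction.moebius d : ℝ) *
          ((commonDivisorCount P N d : ℝ) - N / (d : ℝ) ^ 2) +
        N * (∑ d ∈ (primorial z).divisors, (ArithmeticFunction.moebius d : ℝ) *
          ((d : ℝ) ^ 2)⁻¹ - 6 / Real.pi ^ 2) := by
      rw [e, mul_sub, Finset.mul_sum, ← add_sub_assoc, ← Finset.sum_add_distrib]
      congr 1
      refine Finset.sum_congr rfl fun d _ => ?_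
      rw [div_eq_mul_inv]; ring
    rw [e2]
    refine (abs_add_le _ _).trans (add_le_add ?_ ?_)
    · refine (Finset.abs_sum_le_sum_abs _ _).trans ?_
      have hterm : ∀ d ∈ (primorial z).divisors, |(ArithmeticFunction.moebius d : ℝ) *
          ((commonDivisorCount P N d : ℝ) - N / (d : ℝ) ^ 2)| ≤ K * (N : ℝ) ^ (1 - c) := by
        intro d hd
        have hd1 : 1 ≤ d := Nat.pos_of_mem_divisors hd
        have hd1' : (1 : ℝ) ≤ d := by exact_mod_cast hd1
        have hdN : d ≤ N := ((Nat.divisor_le hd).trans (primorial_le_four_pow z)).trans hz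
        rw [abs_mul]
        have hμ : |(ArithmeticFunction.moebius d : ℝ)| ≤ 1 := by
          exact_mod_cast ArithmeticFunction.abs_moebius_le_one (n := d)
        refine (mul_le_of_le_one_left (abs_nonneg _) hμ).trans ((hcd N d hd1 hdN).trans ?_)
        exact mul_le_mul_of_nonneg_left
          (Real.rpow_le_rpow (by positivity) (div_le_self hN0.le hd1') (by linarith)) hK.le
      refine (Finset.sum_le_card_nsmul _ _ _ hterm).trans ?_
      rw [nsmul_eq_mul, mul_left_comm]
      gcongr
      exact_mod_cast (Nat.card_divisors_le_self _).trans (primorial_le_four_pow z)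
    · rw [abs_mul, abs_of_pos hN0]
      refine (mul_le_mul_of_nonneg_left (abs_sum_divisors_primorial_sub_le z) hN0.le).trans
        (le_of_eq ?_)
      ring
  -- the large primes
  set W := (Finset.Icc 1 N).filter fun p => p.Prime ∧ z < p with hW
  have hprimes : ∑ p ∈ W, (commonDivisorCount P N p : ℝ) ≤
      2 * (N / (z + 1)) + K / c * (N * T ^ (-c)) + T * N.primeCounting := by
    rw [← Finset.sum_filter_add_sum_filter_not W (fun p : ℕ => (p : ℝ) ≤ N / T)]
    refine add_le_add ?_ ?_
    · have hterm : ∀ p ∈ W.filter (fun p : ℕ => (p : ℝ) ≤ N / T),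
          (commonDivisorCount P N p : ℝ) ≤
            N * ((p : ℝ) ^ 2)⁻¹ + K * ((N : ℝ) / p) ^ (1 - c) := by
        intro p hp
        have hp1 := Finset.mem_Icc.1 (Finset.mem_filter.1 (Finset.mem_filter.1 hp).1).1
        have := (abs_le.1 (hcd N p hp1.1 hp1.2)).2
        rw [div_eq_mul_inv] at this
        linarith
      refine (Finset.sum_le_sum hterm).trans ?_
      rw [Finset.sum_add_distrib, ← Finset.mul_sum, ← Finset.mul_sum]
      refine add_le_add ?_ ?_
      · have := sum_inv_sq_le_of_lt (W.filter (fun p : ℕ => (p : ℝ) ≤ N / T)) z fun p hp =>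
          (Finset.mem_filter.1 (Finset.mem_filter.1 hp).1).2.2
        refine (mul_le_mul_of_nonneg_left this hN0.le).trans (le_of_eq ?_)
        ring
      · rw [div_mul_eq_mul_div, mul_div_assoc]
        gcongr
        have hsub : W.filter (fun p : ℕ => (p : ℝ) ≤ N / T) ⊆ Finset.Icc 1 ⌊(N : ℝ) / T⌋₊ := by
          intro p hp
          have h1 := Finset.mem_Icc.1 (Finset.mem_filter.1 (Finset.mem_filter.1 hp).1).1
          exact Finset.mem_Icc.2 ⟨h1.1, Nat.le_floor (Finset.mem_filter.1 hp).2⟩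
        refine (Finset.sum_le_sum_of_subset_of_nonneg hsub fun _ _ _ => by positivity).trans ?_
        have e : ∀ d ∈ Finset.Icc 1 ⌊(N : ℝ) / T⌋₊, ((N : ℝ) / d) ^ (1 - c) =
            (N : ℝ) ^ (1 - c) * (d : ℝ) ^ (c - 1) := by
          intro d _
          rw [Real.div_rpow hN0.le (Nat.cast_nonneg d), div_eq_mul_inv,
            ← Real.rpow_neg (Nat.cast_nonneg d), neg_sub]
        rw [Finset.sum_congr rfl e, ← Finset.mul_sum]
        calc (N : ℝ) ^ (1 - c) * ∑ d ∈ Finset.Icc 1 ⌊(N : ℝ) / T⌋₊, (d : ℝ) ^ (c - 1)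
            ≤ (N : ℝ) ^ (1 - c) * (((N : ℝ) / T) ^ c / c) := by
              gcongr
              refine (sum_Icc_rpow_sub_one_le hc0 hc1.le _).trans ?_
              gcongr
              exact Nat.floor_le (by positivity)
          _ = N * T ^ (-c) / c := by
              rw [Real.div_rpow hN0.le hT0.le, Real.rpow_neg hT0.le, Real.rpow_sub hN0,
                Real.rpow_one]
              have := Real.rpow_pos_of_pos hN0 c
              field_simp
    · have hterm : ∀ p ∈ W.filter (fun p : ℕ => ¬ (p : ℝ) ≤ N / T),
          (commonDivisorCount P N p : ℝ) ≤ T := by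
        intro p hp
        have hp1 := Finset.mem_Icc.1 (Finset.mem_filter.1 (Finset.mem_filter.1 hp).1).1
        have hp0 : (0 : ℝ) < p := by exact_mod_cast hp1.1
        have h1 := not_le.1 (Finset.mem_filter.1 hp).2
        have h2 : (commonDivisorCount P N p : ℝ) ≤ N / p :=
          (Nat.cast_le.2 (commonDivisorCount_le P N hp1.1)).trans Nat.cast_div_le
        refine h2.trans ?_
        rw [div_lt_iff₀ hT0] at h1
        rw [div_le_iff₀ hp0]
        linarith
      refine (Finset.sum_le_card_nsmul _ _ _ hterm).trans ?_
      rw [nsmul_eq_mul, mul_comm]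
      gcongr
      rw [← Nat.primesLE_card_eq_primeCounting]
      refine Finset.card_le_card fun p hp => ?_
      have h1 := Finset.mem_filter.1 (Finset.mem_filter.1 hp).1
      exact Nat.mem_primesLE.2 ⟨(Finset.mem_Icc.1 h1.1).2, h1.2.1⟩
  have hle1 : (coprimeCount P N : ℝ) ≤ siftedCount P N z := by
    exact_mod_cast coprimeCount_natCast_le_siftedCount P N z
  have hle2 : (siftedCount P N z : ℝ) ≤ coprimeCount P N +
      ∑ p ∈ W, (commonDivisorCount P N p : ℝ) := by
    exact_mod_cast siftedCount_le P N z
  have hx1 : 0 ≤ 4 ^ z * (N : ℝ) ^ (1 - c) := by positivity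
  have hx2 : 0 ≤ (N : ℝ) / (z + 1) := by positivity
  have hx3 : 0 ≤ N * T ^ (-c) := by positivity
  have hx4 : 0 ≤ T * N.primeCounting := by positivity
  have hKc : 0 < K / c := by positivity
  have h1 := abs_le.1 hsift
  set x₁ := 4 ^ z * (N : ℝ) ^ (1 - c)
  set x₂ := (N : ℝ) / (z + 1)
  set x₃ := N * T ^ (-c)
  set x₄ := T * N.primeCounting
  have key : |(coprimeCount P N : ℝ) - N * (6 / Real.pi ^ 2)| ≤
      K * x₁ + 4 * x₂ + K / c * x₃ + x₄ := by
    have := mul_nonneg hKc.le hx3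
    rw [abs_le]
    constructor <;> linarith [h1.1, h1.2]
  refine key.trans ?_
  have e : (K + K / c + 4) * (x₁ + x₂ + x₃ + x₄) - (K * x₁ + 4 * x₂ + K / c * x₃ + x₄) =
      (K / c + 4) * x₁ + (K + K / c) * x₂ + (K + 4) * x₃ + (K + K / c + 3) * x₄ := by ring
  have : 0 ≤ (K / c + 4) * x₁ + (K + K / c) * x₂ + (K + 4) * x₃ + (K + K / c + 3) * x₄ := by
    positivity
  linarith

/-! ### Asymptotics -/

lemma eventually_rpow_mul_exp_neg_le_one (s : ℝ) {b : ℝ} (hb : 0 < b) :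
    ∀ᶠ x : ℝ in atTop, x ^ s * Real.exp (-b * x) ≤ 1 :=
  (tendsto_rpow_mul_exp_neg_mul_atTop_nhds_zero s b hb).eventually_le_const one_pos

/-- The sieve bound with its parameters chosen in terms of `L = log X` and `Y = log log X`. -/
theorem NonLiouville.eventually_abs_coprimeCount_sub_le {P : Polynomial ℝ}
    (hP : NonLiouville (P.coeff 1)) : ∃ K : ℝ, 0 < K ∧ ∀ᶠ X : ℝ in atTop,
      |(coprimeCount P X : ℝ) - X * (6 / Real.pi ^ 2)| ≤
        K * (X / (Real.log (Real.log X)) ^ ((1 : ℝ) / 3)) := by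
  obtain ⟨K, c, hK, hc0, hc1, hsieve⟩ := hP.abs_coprimeCount_natCast_sub_le
  refine ⟨K * (4 + 1 + 2 + (Real.log 4 + 1)) + 1, ?_, ?_⟩
  · have : 0 < Real.log 4 := Real.log_pos (by norm_num)
    positivity
  have hlog : Tendsto Real.log atTop atTop := Real.tendsto_log_atTop
  have hloglog : Tendsto (fun X => Real.log (Real.log X)) atTop atTop := hlog.comp hlog
  filter_upwards [eventually_ge_atTop 2, hlog.eventually_ge_atTop 1,
    hloglog.eventually_ge_atTop 1,
    hlog.eventually (eventually_rpow_mul_exp_neg_le_one 3 hc0),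
    hlog.eventually (eventually_rpow_mul_exp_neg_le_one 3 one_pos),
    hlog.eventually_ge_atTop 8,
    hloglog.eventually (eventually_rpow_mul_exp_neg_le_one (1 / 3) (half_pos hc0)),
    hloglog.eventually (eventually_rpow_mul_exp_neg_le_one (1 / 3) one_half_pos),
    Chebyshev.eventually_primeCounting_le one_pos] with X hX2 hL1 hY1 hLc hLone hL8 hYc hYhalf hπ
  set L := Real.log X with hL
  set Y := Real.log L with hY
  have hX0 : 0 < X := by linarith
  have hL0 : 0 < L := by linarith
  have hY0 : 0 < Y := by linarith
  have hexpL : Real.exp L = X := Real.exp_log hX0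
  have hexpY : Real.exp Y = L := Real.exp_log hL0
  have hYL : Y ≤ L := by rw [← hexpY]; linarith [Real.add_one_le_exp Y]
  have hLX : L ≤ X := by rw [← hexpL]; linarith [Real.add_one_le_exp L]
  set W := Y ^ ((1 : ℝ) / 3) with hW
  have hW0 : 0 < W := Real.rpow_pos_of_pos hY0 _
  have hWY : W ≤ Y := by
    calc W ≤ Y ^ (1 : ℝ) := Real.rpow_le_rpow_of_exponent_le hY1 (by norm_num)
      _ = Y := Real.rpow_one Y
  set N := ⌊X⌋₊ with hN
  have hNX : (N : ℝ) ≤ X := Nat.floor_le hX0.le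
  have hXN : X < N + 1 := Nat.lt_floor_add_one X
  have hN1 : 1 ≤ N := Nat.le_floor (by push_cast; linarith)
  have hN0 : (0 : ℝ) < N := by exact_mod_cast hN1
  have hcount : coprimeCount P X = coprimeCount P N := by
    rw [coprimeCount, coprimeCount, Nat.floor_natCast]
  -- `4 ^ z` is then a power of `log X`, and `T` is the square root of `log X`
  set z := ⌈Y⌉₊ with hz
  set T := Real.exp (Y / 2) with hT
  have hT1 : 1 ≤ T := Real.one_le_exp (by linarith)
  have hzY : Y ≤ z := Nat.le_ceil Y
  have h4z : (4 : ℝ) ^ z ≤ 4 * L ^ 2 := by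
    have h1 : (z : ℝ) ≤ Y + 1 := (Nat.ceil_lt_add_one hY0.le).le
    have h2 : Real.log 4 ≤ 2 := by
      have : Real.log 4 = 2 * Real.log 2 := by
        rw [show (4 : ℝ) = 2 ^ 2 by norm_num, Real.log_pow]; norm_num
      linarith [Real.log_two_lt_d9]
    calc (4 : ℝ) ^ z = (4 : ℝ) ^ (z : ℝ) := (Real.rpow_natCast 4 z).symm
      _ ≤ 4 ^ (Y + 1) := Real.rpow_le_rpow_of_exponent_le (by norm_num) h1
      _ = Real.exp (Real.log 4 * Y) * 4 := by
        rw [Real.rpow_add_one (by norm_num), Real.rpow_def_of_pos (by norm_num)]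
      _ ≤ Real.exp (Y + Y) * 4 := by
        gcongr
        linarith [mul_le_mul_of_nonneg_right h2 hY0.le]
      _ = 4 * L ^ 2 := by rw [Real.exp_add, hexpY]; ring
  have hL3 : ∀ x : ℝ, x ^ (3 : ℝ) = x ^ 3 := fun x => by
    rw [← Real.rpow_natCast]; norm_num
  rw [hL3] at hLc hLone
  have hLX3 : L ^ 3 ≤ X := by
    rw [neg_one_mul, Real.exp_neg, hexpL, ← div_eq_mul_inv, div_le_one hX0] at hLone
    exact hLone
  have h4N : 4 ^ z ≤ N := by
    have : ((4 ^ z : ℕ) : ℝ) ≤ N := by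
      push_cast
      have h1 := mul_le_mul_of_nonneg_right hL8 (sq_nonneg L)
      have h2 : L * L ^ 2 = L ^ 3 := by ring
      have h3 : 1 ≤ L ^ 2 := one_le_pow₀ hL1
      linarith
    exact_mod_cast this
  have hmain := hsieve N z T hN1 hT1 h4N
  -- the four error terms
  have e1 : 4 ^ z * (N : ℝ) ^ (1 - c) ≤ 4 * (X / W) := by
    have h1 : (N : ℝ) ^ (1 - c) ≤ X * Real.exp (-c * L) := by
      calc (N : ℝ) ^ (1 - c) ≤ X ^ (1 - c) := Real.rpow_le_rpow hN0.le hNX (by linarith)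
        _ = X * Real.exp (-c * L) := by
          rw [sub_eq_add_neg, Real.rpow_add hX0, Real.rpow_one, Real.rpow_def_of_pos hX0,
            mul_comm (Real.log X)]
    have h2 : L ^ 2 * Real.exp (-c * L) ≤ 1 / W := by
      rw [le_div_iff₀ hW0]
      calc L ^ 2 * Real.exp (-c * L) * W ≤ L ^ 2 * Real.exp (-c * L) * L := by
            gcongr; linarith
        _ = L ^ 3 * Real.exp (-c * L) := by ring
        _ ≤ 1 := hLc
    calc 4 ^ z * (N : ℝ) ^ (1 - c) ≤ (4 * L ^ 2) * (X * Real.exp (-c * L)) := by gcongr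
      _ = 4 * X * (L ^ 2 * Real.exp (-c * L)) := by ring
      _ ≤ 4 * X * (1 / W) := by gcongr
      _ = 4 * (X / W) := by ring
  have e2 : (N : ℝ) / (z + 1) ≤ X / W := by
    gcongr
    linarith
  have e3 : N * T ^ (-c) ≤ 2 * (X / W) := by
    have h1 : T ^ (-c) ≤ 1 / W := by
      rw [hT, ← Real.exp_mul, le_div_iff₀ hW0, mul_comm]
      have : Y / 2 * -c = -(c / 2) * Y := by ring
      rw [this]
      exact hYc
    calc N * T ^ (-c) ≤ X * (1 / W) := by gcongr
      _ = X / W := by ring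
      _ ≤ 2 * (X / W) := by
        have : 0 < X / W := by positivity
        linarith
  have hlog4 : 0 < Real.log 4 := Real.log_pos (by norm_num)
  have e4 : T * N.primeCounting ≤ (Real.log 4 + 1) * (X / W) := by
    have h1 : T / L ≤ 1 / W := by
      rw [div_le_div_iff₀ hL0 hW0, one_mul, ← hexpY, hT, mul_comm]
      have h2 : Real.exp (-(1 / 2) * Y) = Real.exp (Y / 2) / Real.exp Y := by
        rw [← Real.exp_sub]; congr 1; ring
      rw [h2, ← mul_div_assoc, div_le_one (Real.exp_pos _)] at hYhalf
      exact hYhalf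
    calc T * N.primeCounting ≤ T * ((Real.log 4 + 1) * X / L) := by gcongr
      _ = (Real.log 4 + 1) * X * (T / L) := by ring
      _ ≤ (Real.log 4 + 1) * X * (1 / W) := by gcongr
      _ = (Real.log 4 + 1) * (X / W) := by ring
  have e5 : |(N : ℝ) * (6 / Real.pi ^ 2) - X * (6 / Real.pi ^ 2)| ≤ X / W := by
    have h1 : 1 ≤ X / W := by rw [le_div_iff₀ hW0]; linarith
    have h2 : 6 / Real.pi ^ 2 ≤ 1 := by
      rw [div_le_one (by positivity)]; nlinarith [Real.pi_gt_three]
    have h3 : 0 ≤ 6 / Real.pi ^ 2 := by positivity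
    rw [← sub_mul, abs_mul, abs_of_nonneg h3, abs_sub_comm, abs_of_nonneg (by linarith)]
    have h4 := mul_le_mul (by linarith : X - N ≤ 1) h2 h3 zero_le_one
    linarith
  rw [hcount]
  refine (abs_sub_le _ ((N : ℝ) * (6 / Real.pi ^ 2)) _).trans ?_
  rw [add_mul, one_mul]
  refine add_le_add (hmain.trans ?_) e5
  rw [mul_assoc]
  refine mul_le_mul_of_nonneg_left ?_ hK.le
  linarith

theorem mainTheorem1 (P : Polynomial ℝ) (hP : NonLiouville (P.coeff 1)) :
    ((fun X : ℝ => (coprimeCount P X : ℂ) - (X : ℂ) / riemannZeta 2) =O[atTop]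
        fun X : ℝ => X / (Real.log (Real.log X)) ^ ((1 : ℝ) / 3)) ∧
      Tendsto (fun X : ℝ => (coprimeCount P X : ℂ) / (X : ℂ)) atTop (𝓝 (1 / riemannZeta 2)) ∧
      Tendsto (fun X : ℝ => (coprimeCount P X : ℝ) / X) atTop (𝓝 (6 / Real.pi ^ 2)) ∧
      1 / riemannZeta 2 = 6 / (Real.pi : ℂ) ^ 2 := by
  obtain ⟨K, hK, hbound⟩ := hP.eventually_abs_coprimeCount_sub_le
  have hzeta : 1 / riemannZeta 2 = 6 / (Real.pi : ℂ) ^ 2 := by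
    rw [riemannZeta_two, one_div_div]
  have hlim : Tendsto (fun X : ℝ => (coprimeCount P X : ℝ) / X) atTop (𝓝 (6 / Real.pi ^ 2)) := by
    have hW : Tendsto (fun X : ℝ => K * ((Real.log (Real.log X)) ^ ((1 : ℝ) / 3))⁻¹) atTop
        (𝓝 0) := by
      rw [← mul_zero K]
      refine (Tendsto.inv_tendsto_atTop ?_).const_mul K
      exact (tendsto_rpow_atTop (by norm_num)).comp
        (Real.tendsto_log_atTop.comp Real.tendsto_log_atTop)
    rw [tendsto_iff_norm_sub_tendsto_zero]
    refine squeeze_zero' (Eventually.of_forall fun _ => norm_nonneg _) ?_ hW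
    filter_upwards [hbound, eventually_gt_atTop 0] with X hX hX0
    have e : (coprimeCount P X : ℝ) / X - 6 / Real.pi ^ 2 =
        ((coprimeCount P X : ℝ) - X * (6 / Real.pi ^ 2)) / X := by field_simp
    rw [e, norm_div, Real.norm_eq_abs, Real.norm_of_nonneg hX0.le, div_le_iff₀ hX0]
    refine hX.trans (le_of_eq ?_)
    ring
  refine ⟨?_, ?_, hlim, hzeta⟩
  · refine IsBigO.of_bound K (hbound.mono fun X hX => ?_)
    have e : (coprimeCount P X : ℂ) - (X : ℂ) / riemannZeta 2 =
        (((coprimeCount P X : ℝ) - X * (6 / Real.pi ^ 2) : ℝ) : ℂ) := by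
      rw [← mul_one_div, hzeta]; push_cast; ring
    rw [e, Complex.norm_real, Real.norm_eq_abs]
    exact hX.trans (mul_le_mul_of_nonneg_left (Real.le_norm_self _) hK.le)
  · have h := (Complex.continuous_ofReal.tendsto (6 / Real.pi ^ 2)).comp hlim
    rw [hzeta]
    refine (h.congr fun X => ?_).trans (le_of_eq ?_)
    · simp
    · push_cast; rfl
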